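/- For $\alpha,\theta>0$ and $\kappa\in\{0,1,2,\dots\}$, a \emph{Beta chain} with parameters $(\kappa,\alpha,\theta)$ is a Markov chain $(v_i)_{i\ge1}$ of real random variables with initial law $v_1\sim\mathrm{Be}(\alpha,\theta)$ and transition probabilities $$\mathbb P[v_{i+1}\in A\mid v_1,\dots,v_i]=\int_A\sum_{x=0}^{\kappa}\mathrm{Be}(s\mid\alpha+x,\theta+\kappa-x)\,\mathrm{Bin}(x\mid\kappa,v_i)\,ds\quad\text{a.s.},\qquad i\ge 1,\ A\subseteq\mathbb R\text{ Borel},$$ where $\mathrm{Be}(\cdot\mid a,b)$ is the Beta density on $(0,1)$ and $\mathrm{Bin}(x\mid\kappa,p)=\binom{\kappa}{x}p^x(1-p)^{\kappa-x}$ (with $0^0=1$). Its \emph{stick-breaking weights} are $w_1=v_1$ and $w_j=v_j\prod_{i=1}^{j-1}(1-v_i)$ for $j\ge2$. A \emph{size-biased permutation} of a random weight sequence $W=(w_j)_{j\ge1}$ (with a.s. positive, pairwise distinct entries of sum $1$) is a random sequence $(\tilde w_n)_{n\ge1}$, on a possibly enlarged probability space, which is a.s. a permutation of $W$ and satisfies,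 for all $n,j\ge1$, a.s., $$\mathbb P[\tilde w_n=w_j\mid W,\tilde w_1,\dots,\tilde w_{n-1}]=\frac{w_j}{1-\sum_{i=1}^{n-1}\tilde w_i}\,\mathbf 1_{\{w_j\notin\{\tilde w_1,\dots,\tilde w_{n-1}\}\}}.$$ The sequence $W$ is \emph{size-biased ordered} if it has a size-biased permutation and every size-biased permutation of $W$ has the same law as $W$. Let $(w_j^{(\kappa)})_{j\ge1}$ be the stick-breaking weights of a Beta chain with parameters $(\kappa,\alpha,\theta)$; the chains for different $\kappa$ may live on different probability spaces. Then: (i) For $\alpha=1$, $\kappa=0$ and every $\theta>0$, the sequence $(w_j^{(0)})_{j\ge1}$ is size-biased ordered. (ii) For all fixed $\alpha,\theta>0$ and every $j\ge1$, $$\lim_{\kappa\to\infty}\mathbb P\bigl[w_{j+1}^{(\kappa)}<w_j^{(\kappa)}\bigr]=1.$$ -/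

import Mathlib

open MeasureTheory ProbabilityTheory Filter
open scoped Topology

/-- The binomial probability mass function `Bin(x | κ, p)`; for `κ = 0` it is the point mass at
`0`, since `0 ^ 0 = 1`. -/
def binomialWeight (κ : ℕ) (p : ℝ) (x : ℕ) : ℝ :=
  (κ.choose x : ℝ) * p ^ x * (1 - p) ^ (κ - x)

/-- The transition density `s ↦ ∑_{x = 0}^κ Be(s | α + x, θ + κ - x) Bin(x | κ, p)` of the Beta
chain, started from the state `p`. -/
noncomputable def betaChainDensity (κ : ℕ) (α θ p s : ℝ) : ℝ :=
  ∑ x ∈ Finset.range (κ + 1),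
    betaPDFReal (α + x) (θ + κ - x) s * binomialWeight κ p x

/-- `V = (v_i)`, indexed from `0`, is a Beta chain with parameters `(κ, α, θ)`: a Markov chain with
initial law `Be(α, θ)` and with the transition density `betaChainDensity`. The Markov property and
the transition probabilities are expressed together, by conditioning on the whole past. -/
structure IsBetaChain {Ω : Type*} [MeasurableSpace Ω] (P : Measure Ω) (κ : ℕ) (α θ : ℝ)
    (V : ℕ → Ω → ℝ) : Prop where
  measurable : ∀ i, Measurable (V i)
  initial : P.map (V 0) = betaMeasure α θ
  transition : ∀ (n : ℕ) (A : Set ℝ), MeasurableSet A →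
    P⟦V (n + 1) ⁻¹' A | ⨆ i ∈ Finset.range (n + 1),
        MeasurableSpace.comap (V i) inferInstance⟧
      =ᵐ[P] fun ω => ∫ s in A, betaChainDensity κ α θ (V n ω) s

/-- The stick-breaking weights `w_j = v_j ∏_{i < j} (1 - v_i)`, indexed from `0`. -/
def stickBreaking {Ω : Type*} (V : ℕ → Ω → ℝ) (j : ℕ) (ω : Ω) : ℝ :=
  V j ω * ∏ i ∈ Finset.range j, (1 - V i ω)

open scoped Classical in
/-- `W' = (w'_n)` is a size-biased permutation of the weights `W = (w_j)`: almost surely it is a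
permutation of them, and
`P[w'_n = w_j | W, w'_0, …, w'_{n-1}] = w_j / (1 - ∑_{i < n} w'_i)` on the event
`w_j ∉ {w'_0, …, w'_{n-1}}`, and `= 0` off this event. (For `n = 0` this reads
`P[w'_0 = w_j | W] = w_j`.) As usual, the notion is meant for weights which are almost surely
positive, pairwise distinct and of sum one. -/
structure IsSizeBiasedPermutation {Ω : Type*} [MeasurableSpace Ω] (P : Measure Ω)
    (W W' : ℕ → Ω → ℝ) : Prop where
  measurable_weights : ∀ j, Measurable (W j)
  measurable_perm : ∀ n, Measurable (W' n)
  perm : ∀ᵐ ω ∂P, ∃ π : Equiv.Perm ℕ, ∀ n, W' n ω = W (π n) ω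
  cond : ∀ n j : ℕ,
    P⟦{ω | W' n ω = W j ω} |
        (⨆ k, MeasurableSpace.comap (W k) inferInstance) ⊔
          ⨆ i ∈ Finset.range n, MeasurableSpace.comap (W' i) inferInstance⟧
      =ᵐ[P] fun ω =>
        if ∃ i < n, W j ω = W' i ω then 0
        else W j ω / (1 - ∑ i ∈ Finset.range n, W' i ω)

/-- `Q` is the joint law of a copy of the random sequence `W` and of a size-biased permutation of
that copy. -/
structure IsSizeBiasedCoupling {Ω : Type*} [MeasurableSpace Ω] (P : Measure Ω)
    (W : ℕ → Ω → ℝ) (Q : Measure ((ℕ → ℝ) × (ℕ → ℝ))) : Prop where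
  isProbabilityMeasure : IsProbabilityMeasure Q
  map_fst : Q.map Prod.fst = P.map (fun ω j => W j ω)
  sizeBiased : IsSizeBiasedPermutation Q (fun j q => q.1 j) (fun n q => q.2 n)

/-- The random sequence `W` is size-biased ordered: it has a size-biased permutation (on a suitable
probability space), and every size-biased permutation of it has the same law as `W` itself. -/
def IsSizeBiasedOrdered {Ω : Type*} [MeasurableSpace Ω] (P : Measure Ω)
    (W : ℕ → Ω → ℝ) : Prop :=
  (∃ Q, IsSizeBiasedCoupling P W Q) ∧
    ∀ Q, IsSizeBiasedCoupling P W Q → Q.map Prod.snd = P.map (fun ω j => W j ω)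

/-!
The two parts have independent proofs.

**Many trials.** Given `v_i = p`, the next state is a mixture of Beta laws whose variances are at
most `1 / (α + θ + κ)` and whose means are `p` up to a binomial fluctuation, so the mean square of
the jump `v_{i+1} - v_i` is at most `jumpBound κ α θ`, uniformly in `p`, and tends to `0`
(`IsBetaChain.lintegral_sq_jump_le`). Hence `v_j` and `v_{j+1}` are both close to `v_0`, whose law
`Be(α, θ)` does not depend on `κ` and does not charge `0`, with high probability. On this event
`v_{j+1} (1 - v_j) < v_j`, which is equivalent to `w_{j+1} < w_j` as soon as all the `v_i` are in
`(0, 1)`.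

**Size-biased order.** Let `R_n = 1 - ∑_{i < n} w_i`. The proof rests on one property of the law
`μ` of the weights: for every `m`, the measure with density `R_{m+1}` with respect to `μ` is
invariant under the exchange of the positions `m` and `m + 1` (`IsAdjacentSwapInvariant`).

* The property implies that `w` is size-biased ordered. Move to the position `n` a size-biased pick
  among the positions `≥ n`. The law `μ` does not change
  (`IsAdjacentSwapInvariant.tsum_lintegral_pickWeight`): since `w_m = R_m - R_{m+1}`, swap
  invariance makes the sum over the picked positions telescope. Iterating over `n` gives a Markov
  chain of sequences, all with law `μ`, whose picks form a size-biased permutation of the initial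
  sequence (the Ionescu-Tulcea theorem provides the chain, see `pickChain`). The first `n` picks are
  the first `n` entries of the `n`-th sequence, so the picks have law `μ` as well; in particular
  their sum is one, which is why no weight is left out. Finally the conditional probabilities
  determine the joint law of the weights and any of their size-biased permutations
  (`IsSizeBiasedCoupling.map_snd_eq`).
* Stick-breaking with independent `Be(1, θ)` proportions has the property. Splitting off the first
  proportion reduces it to `m = 0`, where it says that the law of `(w_0, w_1)`, with density
  `1 - w_0`, is symmetric: it is proportional to `(1 - x - z) ^ (θ - 1)` on the simplex
  (`lintegral_first_two_weights`).
-/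

/-! ### Moments of the transition density of a Beta chain -/

lemma betaPDFReal_nonneg {a b : ℝ} (ha : 0 < a) (hb : 0 < b) (x : ℝ) :
    0 ≤ betaPDFReal a b x := by
  by_cases hx : 0 < x ∧ x < 1
  · exact (betaPDFReal_pos hx.1 hx.2 ha hb).le
  · simp [betaPDFReal, hx]

lemma integrable_betaPDFReal {a b : ℝ} (ha : 0 < a) (hb : 0 < b) :
    Integrable (betaPDFReal a b) := by
  refine ⟨(measurable_betaPDFReal a b).aestronglyMeasurable, ?_⟩
  rw [hasFiniteIntegral_iff_ofReal (Eventually.of_forall (betaPDFReal_nonneg ha hb))]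
  have := lintegral_betaPDF_eq_one ha hb
  simp only [betaPDF] at this
  simp [this]

lemma integral_betaPDFReal {a b : ℝ} (ha : 0 < a) (hb : 0 < b) :
    ∫ s, betaPDFReal a b s = 1 := by
  rw [integral_eq_lintegral_of_nonneg_ae (Eventually.of_forall (betaPDFReal_nonneg ha hb))
    (measurable_betaPDFReal a b).aestronglyMeasurable]
  have := lintegral_betaPDF_eq_one ha hb
  simp only [betaPDF] at this
  simp [this]

lemma mul_betaPDFReal {a b : ℝ} (ha : 0 < a) (hb : 0 < b) (s : ℝ) :
    s * betaPDFReal a b s = a / (a + b) * betaPDFReal (a + 1) b s := by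
  by_cases hs : 0 < s ∧ s < 1
  · have h1 : ProbabilityTheory.beta (a + 1) b = a / (a + b) * ProbabilityTheory.beta a b := by
      rw [ProbabilityTheory.beta, ProbabilityTheory.beta, Real.Gamma_add_one ha.ne',
        show a + 1 + b = (a + b) + 1 by ring, Real.Gamma_add_one (by positivity)]
      field_simp
    have h2 : s ^ (a + 1 - 1) = s * s ^ (a - 1) := by
      rw [show a + 1 - 1 = (a - 1) + 1 by ring, Real.rpow_add_one hs.1.ne', mul_comm]
    have h3 := (beta_pos ha hb).ne'
    rw [betaPDFReal, betaPDFReal, if_pos hs, if_pos hs, h1, h2]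
    field_simp
  · simp [betaPDFReal, hs]

lemma sq_mul_betaPDFReal {a b : ℝ} (ha : 0 < a) (hb : 0 < b) (s : ℝ) :
    s ^ 2 * betaPDFReal a b s
      = a / (a + b) * ((a + 1) / (a + 1 + b)) * betaPDFReal (a + 1 + 1) b s := by
  rw [pow_two, mul_assoc, mul_betaPDFReal ha hb, mul_left_comm,
    mul_betaPDFReal (by positivity) hb, mul_assoc]

/-- The mean square deviation of the Beta law from a point `p`: the variance is at most
`1 / (a + b)`, and the bias is the distance from `p` to the mean `a / (a + b)`. -/
lemma integral_sq_sub_mul_betaPDFReal_le {a b : ℝ} (ha : 0 < a) (hb : 0 < b) (p : ℝ) :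
    Integrable (fun s => (s - p) ^ 2 * betaPDFReal a b s) ∧
      ∫ s, (s - p) ^ 2 * betaPDFReal a b s ≤ 1 / (a + b) + (a / (a + b) - p) ^ 2 := by
  have e : (fun s => (s - p) ^ 2 * betaPDFReal a b s) = fun s =>
      a / (a + b) * ((a + 1) / (a + 1 + b)) * betaPDFReal (a + 1 + 1) b s
        - 2 * p * (a / (a + b)) * betaPDFReal (a + 1) b s + p ^ 2 * betaPDFReal a b s := by
    funext s
    rw [← sq_mul_betaPDFReal ha hb, mul_assoc (2 * p), ← mul_betaPDFReal ha hb]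
    ring
  have i2 := (integrable_betaPDFReal (a := a + 1 + 1) (by positivity) hb).const_mul
    (a / (a + b) * ((a + 1) / (a + 1 + b)))
  have i1 := (integrable_betaPDFReal (a := a + 1) (by positivity) hb).const_mul
    (2 * p * (a / (a + b)))
  have i0 := (integrable_betaPDFReal ha hb).const_mul (p ^ 2)
  rw [e]
  refine ⟨(i2.sub i1).add i0, ?_⟩
  rw [integral_add (by exact i2.sub i1) i0, integral_sub i2 i1, integral_const_mul,
    integral_const_mul, integral_const_mul, integral_betaPDFReal (by positivity) hb,
    integral_betaPDFReal (by positivity) hb, integral_betaPDFReal ha hb]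
  have key : a / (a + b) * ((a + 1) / (a + 1 + b)) - (a / (a + b)) ^ 2 ≤ 1 / (a + b) := by
    have : a / (a + b) * ((a + 1) / (a + 1 + b)) - (a / (a + b)) ^ 2
        = 1 / (a + b) * (a / (a + b) * (b / (a + 1 + b))) := by
      field_simp; ring
    rw [this]
    have h1 : a / (a + b) ≤ 1 := by rw [div_le_one (by positivity)]; linarith
    have h2 : b / (a + 1 + b) ≤ 1 := by rw [div_le_one (by positivity)]; linarith
    exact mul_le_of_le_one_right (by positivity) (mul_le_one₀ h1 (by positivity) h2)
  nlinarith [key]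

lemma binomialWeight_nonneg {κ : ℕ} {p : ℝ} (h0 : 0 ≤ p) (h1 : p ≤ 1) (x : ℕ) :
    0 ≤ binomialWeight κ p x := by
  have : 0 ≤ 1 - p := by linarith
  unfold binomialWeight
  positivity

lemma sum_binomialWeight (κ : ℕ) (p : ℝ) :
    ∑ x ∈ Finset.range (κ + 1), binomialWeight κ p x = 1 := by
  have := add_pow p (1 - p) κ
  rw [add_sub_cancel, one_pow] at this
  rw [this]
  refine Finset.sum_congr rfl fun x _ => ?_
  unfold binomialWeight
  ring

lemma sum_sq_sub_mul_binomialWeight (κ : ℕ) (p : ℝ) :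
    ∑ x ∈ Finset.range (κ + 1), (κ * p - x) ^ 2 * binomialWeight κ p x = κ * p * (1 - p) := by
  have := congrArg (Polynomial.eval p) (bernsteinPolynomial.variance ℝ κ)
  simp only [Polynomial.eval_finsetSum, bernsteinPolynomial, Polynomial.eval_mul,
    Polynomial.eval_pow, Polynomial.eval_sub, Polynomial.eval_natCast, Polynomial.eval_X,
    Polynomial.eval_one, nsmul_eq_mul] at this
  rw [← this]
  rfl

lemma betaChain_params_pos {κ x : ℕ} {α θ : ℝ} (hα : 0 < α) (hθ : 0 < θ)
    (hx : x ∈ Finset.range (κ + 1)) : 0 < α + x ∧ 0 < θ + κ - x := by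
  have h1 : (x : ℝ) ≤ κ := by exact_mod_cast Finset.mem_range_succ_iff.1 hx
  constructor
  · positivity
  · linarith

lemma betaChainDensity_nonneg {κ : ℕ} {α θ p : ℝ} (hα : 0 < α) (hθ : 0 < θ) (h0 : 0 ≤ p)
    (h1 : p ≤ 1) (s : ℝ) : 0 ≤ betaChainDensity κ α θ p s :=
  Finset.sum_nonneg fun x hx => mul_nonneg
    (betaPDFReal_nonneg (betaChain_params_pos hα hθ hx).1 (betaChain_params_pos hα hθ hx).2 s)
    (binomialWeight_nonneg h0 h1 x)

lemma integrable_betaChainDensity {κ : ℕ} {α θ : ℝ} (hα : 0 < α) (hθ : 0 < θ) (p : ℝ) :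
    Integrable (betaChainDensity κ α θ p) := by
  unfold betaChainDensity
  exact integrable_finsetSum _ fun x hx => (integrable_betaPDFReal
    (betaChain_params_pos hα hθ hx).1 (betaChain_params_pos hα hθ hx).2).mul_const _

lemma measurable_betaChainDensity (κ : ℕ) (α θ : ℝ) :
    Measurable fun q : ℝ × ℝ => betaChainDensity κ α θ q.1 q.2 := by
  unfold betaChainDensity binomialWeight
  exact Finset.measurable_sum _ fun x _ =>
    ((measurable_betaPDFReal _ _).comp measurable_snd).mul (by fun_prop)

/-- Bound for the mean square jump of a Beta chain with parameters `(κ, α, θ)`, uniform over the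
state from which it jumps. -/
noncomputable def jumpBound (κ : ℕ) (α θ : ℝ) : ℝ :=
  1 / (α + θ + κ) + 2 * (κ + (α + θ) ^ 2) / (α + θ + κ) ^ 2

lemma integral_sq_sub_mul_betaChainDensity_le {κ : ℕ} {α θ p : ℝ} (hα : 0 < α) (hθ : 0 < θ)
    (h0 : 0 ≤ p) (h1 : p ≤ 1) :
    Integrable (fun s => (s - p) ^ 2 * betaChainDensity κ α θ p s) ∧
      ∫ s, (s - p) ^ 2 * betaChainDensity κ α θ p s ≤ jumpBound κ α θ := by
  have e : (fun s => (s - p) ^ 2 * betaChainDensity κ α θ p s) = fun s =>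
      ∑ x ∈ Finset.range (κ + 1),
        (s - p) ^ 2 * betaPDFReal (α + x) (θ + κ - x) s * binomialWeight κ p x := by
    funext s
    simp only [betaChainDensity, Finset.mul_sum, mul_assoc]
  have hi : ∀ x ∈ Finset.range (κ + 1), Integrable fun s =>
      (s - p) ^ 2 * betaPDFReal (α + x) (θ + κ - x) s * binomialWeight κ p x := fun x hx =>
    (integral_sq_sub_mul_betaPDFReal_le (betaChain_params_pos hα hθ hx).1
      (betaChain_params_pos hα hθ hx).2 p).1.mul_const _
  rw [e]
  refine ⟨integrable_finsetSum _ hi, ?_⟩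
  rw [integral_finsetSum _ hi]
  have hN : 0 < α + θ + κ := by positivity
  calc ∑ x ∈ Finset.range (κ + 1),
        ∫ s, (s - p) ^ 2 * betaPDFReal (α + x) (θ + κ - x) s * binomialWeight κ p x
      ≤ ∑ x ∈ Finset.range (κ + 1), (1 / (α + θ + κ) + 2 * (α + θ) ^ 2 / (α + θ + κ) ^ 2
          + 2 / (α + θ + κ) ^ 2 * (κ * p - x) ^ 2) * binomialWeight κ p x := by
        refine Finset.sum_le_sum fun x hx => ?_
        rw [integral_mul_const]
        refine mul_le_mul_of_nonneg_right ?_ (binomialWeight_nonneg h0 h1 x)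
        refine (integral_sq_sub_mul_betaPDFReal_le (betaChain_params_pos hα hθ hx).1
          (betaChain_params_pos hα hθ hx).2 p).2.trans ?_
        rw [show α + x + (θ + κ - x) = α + θ + κ by ring, add_assoc (1 / _)]
        refine add_le_add le_rfl ?_
        have hb : (α - (α + θ) * p) ^ 2 ≤ (α + θ) ^ 2 := by
          apply sq_le_sq'
          · nlinarith
          · nlinarith
        have : (α + x) / (α + θ + κ) - p
            = ((α - (α + θ) * p) - (κ * p - x)) / (α + θ + κ) := by field_simp; ring
        rw [this, div_pow, mul_comm (2 / _), ← mul_div_assoc, ← add_div]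
        refine div_le_div_of_nonneg_right ?_ (by positivity)
        nlinarith [sq_nonneg ((α - (α + θ) * p) + (κ * p - x))]
    _ = 1 / (α + θ + κ) + 2 * (α + θ) ^ 2 / (α + θ + κ) ^ 2
          + 2 / (α + θ + κ) ^ 2 * (κ * p * (1 - p)) := by
        simp only [add_mul _ _ (binomialWeight _ _ _)]
        rw [Finset.sum_add_distrib, Finset.sum_add_distrib, ← Finset.mul_sum, ← Finset.mul_sum,
          sum_binomialWeight, ← sum_sq_sub_mul_binomialWeight, Finset.mul_sum]
        simp only [mul_one, mul_assoc]
    _ ≤ jumpBound κ α θ := by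
        have : (κ : ℝ) * p * (1 - p) ≤ κ := by
          rw [mul_assoc]
          exact mul_le_of_le_one_right (by positivity) (by nlinarith)
        have h2 : 2 / (α + θ + κ) ^ 2 * (κ * p * (1 - p)) ≤ 2 / (α + θ + κ) ^ 2 * κ := by gcongr
        unfold jumpBound
        calc _ ≤ 1 / (α + θ + κ) + 2 * (α + θ) ^ 2 / (α + θ + κ) ^ 2
              + 2 / (α + θ + κ) ^ 2 * κ := by gcongr
          _ = _ := by ring

lemma tendsto_jumpBound (α θ : ℝ) :
    Tendsto (fun κ : ℕ => jumpBound κ α θ) atTop (𝓝 0) := by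
  have hN : Tendsto (fun κ : ℕ => α + θ + κ) atTop atTop :=
    tendsto_atTop_add_const_left _ _ tendsto_natCast_atTop_atTop
  have hi : Tendsto (fun κ : ℕ => (α + θ + κ)⁻¹) atTop (𝓝 0) := tendsto_inv_atTop_zero.comp hN
  have e : (fun κ : ℕ => jumpBound κ α θ) =ᶠ[atTop] fun κ : ℕ =>
      (α + θ + κ)⁻¹ + 2 * ((α + θ + κ)⁻¹ + ((α + θ) ^ 2 - (α + θ)) * (α + θ + κ)⁻¹ ^ 2) := by
    filter_upwards [hN.eventually_gt_atTop 0] with κ hκ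
    unfold jumpBound
    field_simp
    ring
  rw [tendsto_congr' e]
  simpa using hi.add ((hi.add ((hi.pow 2).const_mul ((α + θ) ^ 2 - (α + θ)))).const_mul 2)

lemma betaMeasure_ae_mem_Ioo (a b : ℝ) : ∀ᵐ x ∂betaMeasure a b, x ∈ Set.Ioo 0 1 := by
  rw [ae_iff, betaMeasure]
  change volume.withDensity _ (Set.Ioo (0 : ℝ) 1)ᶜ = 0
  rw [withDensity_apply _ measurableSet_Ioo.compl]
  refine setLIntegral_eq_zero measurableSet_Ioo.compl fun x hx => ?_
  have : ¬ (0 < x ∧ x < 1) := hx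
  simp [betaPDF, betaPDFReal, this]

/-! ### Beta chains with many trials -/

namespace IsBetaChain

variable {Ω : Type*} [MeasurableSpace Ω] {P : Measure Ω} {κ : ℕ} {α θ : ℝ} {V : ℕ → Ω → ℝ}

lemma past_le (h : IsBetaChain P κ α θ V) (n : ℕ) :
    (⨆ i ∈ Finset.range (n + 1), MeasurableSpace.comap (V i) inferInstance)
      ≤ (inferInstance : MeasurableSpace Ω) :=
  iSup₂_le fun i _ => (h.measurable i).comap_le

variable [IsProbabilityMeasure P]

lemma real_inter_preimage (h : IsBetaChain P κ α θ V) (n : ℕ) {B : Set Ω}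
    (hB : MeasurableSet[⨆ i ∈ Finset.range (n + 1),
      MeasurableSpace.comap (V i) inferInstance] B) {A : Set ℝ} (hA : MeasurableSet A) :
    P.real (B ∩ V (n + 1) ⁻¹' A) = ∫ ω in B, (∫ s in A, betaChainDensity κ α θ (V n ω) s) ∂P := by
  have hm := h.past_le n
  have hA' : MeasurableSet (V (n + 1) ⁻¹' A) := h.measurable _ hA
  rw [← setIntegral_congr_ae (hm _ hB) ((h.transition n A hA).mono fun ω hω _ => hω),
    setIntegral_condExp hm ((integrable_const _).indicator hA') hB,
    setIntegral_indicator hA', setIntegral_const, smul_eq_mul, mul_one]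

lemma ae_mem_Ioo (h : IsBetaChain P κ α θ V) (n : ℕ) : ∀ᵐ ω ∂P, V n ω ∈ Set.Ioo 0 1 := by
  cases n with
  | zero =>
    refine ae_of_ae_map (h.measurable 0).aemeasurable ?_
    rw [h.initial]
    exact betaMeasure_ae_mem_Ioo α θ
  | succ n =>
    have := h.real_inter_preimage n MeasurableSet.univ (measurableSet_Ioo (a := (0 : ℝ))
      (b := 1)).compl
    have h0 : ∀ p, ∫ s in (Set.Ioo (0 : ℝ) 1)ᶜ, betaChainDensity κ α θ p s = 0 := fun p => by
      refine setIntegral_eq_zero_of_forall_eq_zero fun s hs => ?_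
      have : ¬ (0 < s ∧ s < 1) := hs
      simp [betaChainDensity, betaPDFReal, this]
    simp only [h0, integral_zero, Set.univ_inter] at this
    rw [measureReal_eq_zero_iff] at this
    exact this

/-- The joint law of two consecutive states of a Beta chain. -/
lemma map_pair (h : IsBetaChain P κ α θ V) (hα : 0 < α) (hθ : 0 < θ) (n : ℕ) :
    P.map (fun ω => (V n ω, V (n + 1) ω)) = ((P.map (V n)).prod volume).withDensity
      fun q => ENNReal.ofReal (betaChainDensity κ α θ q.1 q.2) := by
  have hp : Measurable fun ω => (V n ω, V (n + 1) ω) :=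
    (h.measurable n).prodMk (h.measurable (n + 1))
  have hd := (measurable_betaChainDensity κ α θ).ennreal_ofReal
  have : IsProbabilityMeasure (P.map (V n)) := Measure.isProbabilityMeasure_map
    (h.measurable n).aemeasurable
  have : IsProbabilityMeasure (P.map fun ω => (V n ω, V (n + 1) ω)) :=
    Measure.isProbabilityMeasure_map hp.aemeasurable
  refine Measure.ext_prod fun {s t} hs ht => ?_
  have hB : MeasurableSet[⨆ i ∈ Finset.range (n + 1),
      MeasurableSpace.comap (V i) inferInstance] (V n ⁻¹' s) :=
    le_iSup₂ (f := fun i (_ : i ∈ Finset.range (n + 1)) =>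
      MeasurableSpace.comap (V i) inferInstance) n (Finset.self_mem_range_succ n) _ ⟨s, hs, rfl⟩
  have hint : Integrable (fun ω => ∫ r in t, betaChainDensity κ α θ (V n ω) r) P :=
    integrable_condExp.congr (h.transition n t ht)
  rw [Measure.map_apply hp (hs.prod ht), withDensity_apply _ (hs.prod ht), ← Measure.prod_restrict,
    lintegral_prod _ hd.aemeasurable, Measure.restrict_map (h.measurable n) hs,
    lintegral_map (Measurable.lintegral_prod_right hd) (h.measurable n)]
  have e : (fun ω => (V n ω, V (n + 1) ω)) ⁻¹' s ×ˢ t = V n ⁻¹' s ∩ V (n + 1) ⁻¹' t := rfl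
  rw [e, ← ofReal_measureReal, h.real_inter_preimage n hB ht,
    ofReal_integral_eq_lintegral_ofReal hint.integrableOn]
  · refine lintegral_congr_ae (ae_restrict_of_ae ?_)
    filter_upwards [h.ae_mem_Ioo n] with ω hω
    rw [ofReal_integral_eq_lintegral_ofReal (integrable_betaChainDensity hα hθ _).integrableOn
      (Eventually.of_forall fun r => betaChainDensity_nonneg hα hθ hω.1.le hω.2.le r)]
  · refine ae_restrict_of_ae ?_
    filter_upwards [h.ae_mem_Ioo n] with ω hω
    exact integral_nonneg fun r => betaChainDensity_nonneg hα hθ hω.1.le hω.2.le r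

lemma lintegral_sq_jump_le (h : IsBetaChain P κ α θ V) (hα : 0 < α) (hθ : 0 < θ) (n : ℕ) :
    ∫⁻ ω, ENNReal.ofReal ((V (n + 1) ω - V n ω) ^ 2) ∂P ≤ ENNReal.ofReal (jumpBound κ α θ) := by
  have hp : Measurable fun ω => (V n ω, V (n + 1) ω) :=
    (h.measurable n).prodMk (h.measurable (n + 1))
  have hd := (measurable_betaChainDensity κ α θ).ennreal_ofReal
  have hg : Measurable fun q : ℝ × ℝ => ENNReal.ofReal ((q.2 - q.1) ^ 2) := by fun_prop
  have : IsProbabilityMeasure (P.map (V n)) := Measure.isProbabilityMeasure_map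
    (h.measurable n).aemeasurable
  have e := lintegral_map (μ := P) hg hp
  simp only at e
  rw [← e, h.map_pair hα hθ, lintegral_withDensity_eq_lintegral_mul _ hd hg,
    lintegral_prod _ (hd.mul hg).aemeasurable,
    lintegral_map (Measurable.lintegral_prod_right (hd.mul hg)) (h.measurable n)]
  calc _ ≤ ∫⁻ _, ENNReal.ofReal (jumpBound κ α θ) ∂P := by
        refine lintegral_mono_ae ?_
        filter_upwards [h.ae_mem_Ioo n] with ω hω
        have hb := integral_sq_sub_mul_betaChainDensity_le (κ := κ) hα hθ hω.1.le hω.2.le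
        refine le_trans (le_of_eq ?_) (ENNReal.ofReal_le_ofReal hb.2)
        rw [ofReal_integral_eq_lintegral_ofReal hb.1 (Eventually.of_forall fun s =>
          mul_nonneg (sq_nonneg _) (betaChainDensity_nonneg hα hθ hω.1.le hω.2.le s))]
        refine lintegral_congr fun s => ?_
        rw [ENNReal.ofReal_mul (sq_nonneg _), mul_comm]
        rfl
    _ = _ := by simp

lemma measure_jump_le (h : IsBetaChain P κ α θ V) (hα : 0 < α) (hθ : 0 < θ) (n : ℕ) {δ : ℝ}
    (hδ : 0 < δ) :
    P {ω | δ ≤ |V (n + 1) ω - V n ω|} ≤ ENNReal.ofReal (jumpBound κ α θ / δ ^ 2) := by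
  have hm : Measurable fun ω => ENNReal.ofReal ((V (n + 1) ω - V n ω) ^ 2) :=
    (((h.measurable _).sub (h.measurable _)).pow_const 2).ennreal_ofReal
  have hle := (mul_meas_ge_le_lintegral (μ := P) hm (ENNReal.ofReal (δ ^ 2))).trans
    (h.lintegral_sq_jump_le hα hθ n)
  have hs : {ω | δ ≤ |V (n + 1) ω - V n ω|}
      ⊆ {ω | ENNReal.ofReal (δ ^ 2) ≤ ENNReal.ofReal ((V (n + 1) ω - V n ω) ^ 2)} := fun ω hω =>
    ENNReal.ofReal_le_ofReal (by
      rw [← sq_abs (V (n + 1) ω - V n ω)]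
      exact pow_le_pow_left₀ hδ.le hω 2)
  rw [ENNReal.ofReal_div_of_pos (by positivity), ENNReal.le_div_iff_mul_le
    (Or.inl (by simpa using hδ.ne')) (Or.inl ENNReal.ofReal_ne_top), mul_comm]
  exact le_trans (by gcongr) hle

end IsBetaChain

section ManyTrials

variable {Ω : ℕ → Type*} [∀ κ, MeasurableSpace (Ω κ)] {P : ∀ κ, Measure (Ω κ)}
  [∀ κ, IsProbabilityMeasure (P κ)] {α θ : ℝ} {V : ∀ κ, ℕ → Ω κ → ℝ}

lemma tendsto_measure_jump (hα : 0 < α) (hθ : 0 < θ)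
    (h : ∀ κ, IsBetaChain (P κ) κ α θ (V κ)) (n : ℕ) {δ : ℝ} (hδ : 0 < δ) :
    Tendsto (fun κ => P κ {ω | δ ≤ |V κ (n + 1) ω - V κ n ω|}) atTop (𝓝 0) := by
  refine tendsto_of_tendsto_of_tendsto_of_le_of_le tendsto_const_nhds ?_ (fun _ => zero_le)
    fun κ => (h κ).measure_jump_le hα hθ n hδ
  have := ENNReal.tendsto_ofReal ((tendsto_jumpBound α θ).div_const (δ ^ 2))
  simpa using this

lemma tendsto_measure_dist_initial (hα : 0 < α) (hθ : 0 < θ)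
    (h : ∀ κ, IsBetaChain (P κ) κ α θ (V κ)) (n : ℕ) {δ : ℝ} (hδ : 0 < δ) :
    Tendsto (fun κ => P κ {ω | δ ≤ |V κ n ω - V κ 0 ω|}) atTop (𝓝 0) := by
  induction n generalizing δ with
  | zero => simp [hδ.not_ge]
  | succ n ih =>
    have := (tendsto_measure_jump hα hθ h n (half_pos hδ)).add (ih (half_pos hδ))
    rw [add_zero] at this
    refine tendsto_of_tendsto_of_tendsto_of_le_of_le tendsto_const_nhds this
      (fun _ => zero_le) fun κ => ?_
    refine le_trans (measure_mono fun ω hω => ?_) (measure_union_le _ _)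
    by_contra hc
    simp only [Set.mem_union, Set.mem_ofPred_eq, not_or, not_le] at hc hω
    have := abs_sub_le (V κ (n + 1) ω) (V κ n ω) (V κ 0 ω)
    linarith

/-- For a large number of trials a Beta chain hardly moves, and a stick-breaking sequence with
constant proportions is decreasing. -/
theorem tendsto_measure_stickBreaking_succ_lt (hα : 0 < α) (hθ : 0 < θ)
    (h : ∀ κ, IsBetaChain (P κ) κ α θ (V κ)) (j : ℕ) :
    Tendsto (fun κ => P κ {ω | stickBreaking (V κ) (j + 1) ω < stickBreaking (V κ) j ω})
      atTop (𝓝 1) := by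
  have := isProbabilityMeasureBeta hα hθ
  have hm : ∀ κ, MeasurableSet {ω | stickBreaking (V κ) (j + 1) ω < stickBreaking (V κ) j ω} := by
    intro κ
    have hV : ∀ i, Measurable (V κ i) := (h κ).measurable
    refine measurableSet_lt ?_ ?_ <;> unfold stickBreaking <;> fun_prop
  have hsmall : Tendsto (fun m : ℕ => betaMeasure α θ (Set.Iic (1 / ((m : ℝ) + 1)))) atTop
      (𝓝 0) := by
    have e : betaMeasure α θ (⋂ m : ℕ, Set.Iic (1 / ((m : ℝ) + 1))) = 0 := by
      have hsub : (⋂ m : ℕ, Set.Iic (1 / ((m : ℝ) + 1))) ⊆ Set.Iic 0 := fun x hx =>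
        show x ≤ 0 from ge_of_tendsto' tendsto_one_div_add_atTop_nhds_zero_nat
          fun m => Set.mem_iInter.1 hx m
      refine measure_mono_null hsub ?_
      rw [betaMeasure, withDensity_apply _ measurableSet_Iic]
      exact setLIntegral_eq_zero measurableSet_Iic fun x hx => betaPDF_eq_zero_of_nonpos hx
    rw [← e]
    refine tendsto_measure_iInter_atTop (fun m => measurableSet_Iic.nullMeasurableSet) ?_
      ⟨0, measure_ne_top _ _⟩
    intro m m' hmm
    exact Set.Iic_subset_Iic.2 (one_div_le_one_div_of_le (by positivity) (by gcongr))
  suffices hc : Tendsto (fun κ => P κ {ω | stickBreaking (V κ) (j + 1) ω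
      < stickBreaking (V κ) j ω}ᶜ) atTop (𝓝 0) by
    have h1 := ENNReal.Tendsto.sub tendsto_const_nhds hc (Or.inl ENNReal.one_ne_top)
    rw [tsub_zero] at h1
    refine h1.congr fun κ => ?_
    rw [prob_compl_eq_one_sub (hm κ), ENNReal.sub_sub_cancel ENNReal.one_ne_top prob_le_one]
  rw [ENNReal.tendsto_nhds_zero]
  intro η hη
  have hη2 : 0 < η / 2 := ENNReal.half_pos hη.ne'
  obtain ⟨m, hmη⟩ := ((ENNReal.tendsto_nhds_zero.1 hsmall) (η / 2) hη2).exists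
  -- If `v_0 > ε` and both `v_j - v_0` and `v_{j+1} - v_j` are below `ε ^ 2 / 4`, then
  -- `v_j > ε / 2`, so that `v_{j+1} - v_j < v_j ^ 2`; this gives `v_{j+1} (1 - v_j) < v_j`.
  set ε : ℝ := 1 / ((m : ℝ) + 1) with hε
  have hε0 : 0 < ε := by positivity
  have hε1 : ε ≤ 1 := by
    rw [hε, div_le_one (by positivity)]
    linarith [(Nat.cast_nonneg m : (0 : ℝ) ≤ m)]
  have hδ : 0 < ε ^ 2 / 4 := by positivity
  have hlim := (tendsto_measure_dist_initial hα hθ h j hδ).add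
    (tendsto_measure_jump hα hθ h j hδ)
  rw [add_zero] at hlim
  filter_upwards [(ENNReal.tendsto_nhds_zero.1 hlim) (η / 2) hη2] with κ hκ
  have hI : ∀ᵐ ω ∂P κ, ∀ i, V κ i ω ∈ Set.Ioo 0 1 := ae_all_iff.2 (h κ).ae_mem_Ioo
  calc P κ {ω | stickBreaking (V κ) (j + 1) ω < stickBreaking (V κ) j ω}ᶜ
      ≤ P κ (V κ 0 ⁻¹' Set.Iic ε ∪ ({ω | ε ^ 2 / 4 ≤ |V κ j ω - V κ 0 ω|} ∪
          {ω | ε ^ 2 / 4 ≤ |V κ (j + 1) ω - V κ j ω|})) := by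
        refine measure_mono_ae ?_
        filter_upwards [hI] with ω hω hbad
        refine by_contra fun hc => hbad ?_
        have hc' : ¬ (V κ 0 ω ≤ ε ∨ ε ^ 2 / 4 ≤ |V κ j ω - V κ 0 ω| ∨
          ε ^ 2 / 4 ≤ |V κ (j + 1) ω - V κ j ω|) := hc
        simp only [not_or, not_le, abs_lt] at hc'
        obtain ⟨h0, h1, h2⟩ := hc'
        have hprod : 0 < ∏ i ∈ Finset.range j, (1 - V κ i ω) :=
          Finset.prod_pos fun i _ => sub_pos.2 (hω i).2
        have hj : ε / 2 < V κ j ω := by nlinarith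
        have hj1 := (hω j).2
        have hstep : V κ (j + 1) ω * (1 - V κ j ω) < V κ j ω := by nlinarith
        change stickBreaking (V κ) (j + 1) ω < stickBreaking (V κ) j ω
        unfold stickBreaking
        rw [Finset.prod_range_succ, mul_comm (∏ i ∈ _, _), ← mul_assoc]
        exact mul_lt_mul_of_pos_right hstep hprod
    _ ≤ P κ (V κ 0 ⁻¹' Set.Iic ε) + (P κ {ω | ε ^ 2 / 4 ≤ |V κ j ω - V κ 0 ω|} +
          P κ {ω | ε ^ 2 / 4 ≤ |V κ (j + 1) ω - V κ j ω|}) :=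
        (measure_union_le _ _).trans (by gcongr; exact measure_union_le _ _)
    _ ≤ η / 2 + η / 2 := by
        refine add_le_add ?_ hκ
        rw [← Measure.map_apply ((h κ).measurable 0) measurableSet_Iic, (h κ).initial]
        exact hmη
    _ = η := ENNReal.add_halves η

end ManyTrials

/-! ### Size-biased picks from a sequence of weights -/

/-- The mass `1 - ∑_{i < n} s_i` left by the first `n` weights. -/
def residualMass (s : ℕ → ℝ) (n : ℕ) : ℝ := 1 - ∑ i ∈ Finset.range n, s i

/-- Positive, pairwise distinct weights of sum one. -/
structure IsProperWeights (s : ℕ → ℝ) : Prop where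
  pos : ∀ i, 0 < s i
  injective : Function.Injective s
  hasSum : HasSum s 1

/-- The permutation of the positions for which `s ∘ bringForward n m` is the sequence `s` with the
entry at position `n + m` moved to position `n`, the entries at `n, …, n + m - 1` being shifted by
one. -/
def bringForward (n : ℕ) : ℕ → Equiv.Perm ℕ
  | 0 => 1
  | m + 1 => Equiv.swap (n + m) (n + m + 1) * bringForward n m

lemma bringForward_self (n m : ℕ) : bringForward n m n = n + m := by
  induction m with
  | zero => rfl
  | succ m ih => rw [bringForward, Equiv.Perm.mul_apply, ih, Equiv.swap_apply_left, add_assoc]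

lemma bringForward_of_lt {n i : ℕ} (hi : i < n) (m : ℕ) : bringForward n m i = i := by
  induction m with
  | zero => rfl
  | succ m ih =>
    rw [bringForward, Equiv.Perm.mul_apply, ih, Equiv.swap_apply_of_ne_of_ne (by lia) (by lia)]

lemma residualMass_succ (s : ℕ → ℝ) (n : ℕ) : residualMass s (n + 1) = residualMass s n - s n := by
  unfold residualMass
  rw [Finset.sum_range_succ]
  ring

lemma residualMass_congr {s t : ℕ → ℝ} {n : ℕ} (h : ∀ i < n, s i = t i) :
    residualMass s n = residualMass t n := by
  unfold residualMass
  rw [Finset.sum_congr rfl fun i hi => h i (Finset.mem_range.1 hi)]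

@[fun_prop]
lemma measurable_residualMass (n : ℕ) : Measurable fun s : ℕ → ℝ => residualMass s n := by
  unfold residualMass
  fun_prop

lemma measurable_comp_perm (π : Equiv.Perm ℕ) : Measurable fun (s : ℕ → ℝ) => s ∘ π :=
  measurable_pi_lambda _ fun i => measurable_pi_apply (π i)

lemma tendsto_residualMass {s : ℕ → ℝ} (hs : HasSum s 1) :
    Tendsto (residualMass s) atTop (𝓝 0) := by
  have := (tendsto_const_nhds (x := (1 : ℝ))).sub hs.tendsto_sum_nat
  rwa [sub_self] at this

namespace IsProperWeights

variable {s : ℕ → ℝ}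

lemma residualMass_pos (hs : IsProperWeights s) (n : ℕ) : 0 < residualMass s n := by
  have h1 := sum_le_hasSum (Finset.range (n + 1)) (fun i _ => (hs.pos i).le) hs.hasSum
  rw [Finset.sum_range_succ] at h1
  have h2 := hs.pos n
  unfold residualMass
  linarith

lemma residualMass_antitone (hs : IsProperWeights s) : Antitone (residualMass s) :=
  antitone_nat_of_succ_le fun n => by
    rw [residualMass_succ]
    linarith [hs.pos n]

end IsProperWeights

/-- The probability that a size-biased pick among the weights at the positions `≥ n` selects the
position `n + m`. -/
noncomputable def pickWeight (n m : ℕ) (s : ℕ → ℝ) : ENNReal :=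
  ENNReal.ofReal (s (n + m) / residualMass s n)

@[fun_prop]
lemma measurable_pickWeight (n m : ℕ) : Measurable (pickWeight n m) := by
  unfold pickWeight
  fun_prop

lemma IsProperWeights.tsum_pickWeight {s : ℕ → ℝ} (hs : IsProperWeights s) (n : ℕ) :
    ∑' m, pickWeight n m s = 1 := by
  have h : HasSum (fun m => s (n + m) / residualMass s n) 1 := by
    rw [← div_self (hs.residualMass_pos n).ne']
    refine HasSum.div_const ?_ _
    simpa [add_comm, residualMass] using (hasSum_nat_add_iff' n).2 hs.hasSum
  unfold pickWeight
  rw [← ENNReal.ofReal_tsum_of_nonneg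
    (fun m => div_nonneg (hs.pos _).le (hs.residualMass_pos n).le) h.summable, h.tsum_eq,
    ENNReal.ofReal_one]

/-- The law `μ` of a random sequence, with the density `1 - ∑_{i ≤ m} s_i`, is invariant under
the exchange of the positions `m` and `m + 1`. -/
def IsAdjacentSwapInvariant (μ : Measure (ℕ → ℝ)) : Prop :=
  ∀ (m : ℕ) (F : (ℕ → ℝ) → ENNReal), Measurable F →
    ∫⁻ s, ENNReal.ofReal (residualMass s (m + 1)) * F (s ∘ Equiv.swap m (m + 1)) ∂μ
      = ∫⁻ s, ENNReal.ofReal (residualMass s (m + 1)) * F s ∂μ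

/-- A size-biased pick among the positions `≥ n`, moved to the position `n`, does not change the
law. The sum telescopes: by swap invariance, the part of the integral of `F` not accounted for by
the first `m` terms is the integral of `F (s ∘ bringForward n m)` with the density
`residualMass s (n + m) / residualMass s n`, which tends to `0`. -/
lemma IsAdjacentSwapInvariant.tsum_lintegral_pickWeight {μ : Measure (ℕ → ℝ)}
    [IsProbabilityMeasure μ] (hμ : IsAdjacentSwapInvariant μ) (hp : ∀ᵐ s ∂μ, IsProperWeights s)
    (n : ℕ) {F : (ℕ → ℝ) → ENNReal} (hF : Measurable F) (hF1 : ∀ s, F s ≤ 1) :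
    ∑' m, ∫⁻ s, pickWeight n m s * F (s ∘ bringForward n m) ∂μ = ∫⁻ s, F s ∂μ := by
  set D : ℕ → ENNReal := fun m =>
    ∫⁻ s, ENNReal.ofReal (residualMass s (n + m) / residualMass s n)
      * F (s ∘ bringForward n m) ∂μ with hD
  have hFm : ∀ m, Measurable fun s : ℕ → ℝ => F (s ∘ bringForward n m) := fun m =>
    hF.comp (measurable_comp_perm _)
  have hstep : ∀ m, D m = ∫⁻ s, pickWeight n m s * F (s ∘ bringForward n m) ∂μ + D (m + 1) := by
    intro m
    set H : (ℕ → ℝ) → ENNReal := fun s =>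
      ENNReal.ofReal (1 / residualMass s n) * F (s ∘ bringForward n m) with hH
    have hHm : Measurable H := by
      have := hFm m
      fun_prop
    have e := hμ (n + m) H hHm
    have e1 : D (m + 1)
        = ∫⁻ s, ENNReal.ofReal (residualMass s (n + m + 1))
            * H (s ∘ Equiv.swap (n + m) (n + m + 1)) ∂μ := by
      refine lintegral_congr_ae ?_
      filter_upwards [hp] with s hs
      have hr : residualMass (s ∘ Equiv.swap (n + m) (n + m + 1)) n = residualMass s n :=
        residualMass_congr fun i hi => by
          rw [Function.comp_apply, Equiv.swap_apply_of_ne_of_ne (by lia) (by lia)]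
      simp only [hH, hr]
      rw [← mul_assoc, ← ENNReal.ofReal_mul (hs.residualMass_pos _).le, mul_one_div]
      rfl
    rw [e1, e, ← lintegral_add_left (by exact (measurable_pickWeight n m).mul (hFm m))]
    refine lintegral_congr_ae ?_
    filter_upwards [hp] with s hs
    simp only [hH]
    rw [← mul_assoc, ← ENNReal.ofReal_mul (hs.residualMass_pos _).le, mul_one_div, ← add_mul,
      pickWeight, ← ENNReal.ofReal_add (div_nonneg (hs.pos _).le (hs.residualMass_pos _).le)
        (div_nonneg (hs.residualMass_pos _).le (hs.residualMass_pos _).le), residualMass_succ]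
    congr 2
    ring
  have hsum : ∀ m, ∫⁻ s, F s ∂μ
      = ∑ k ∈ Finset.range m, ∫⁻ s, pickWeight n k s * F (s ∘ bringForward n k) ∂μ + D m := by
    intro m
    induction m with
    | zero =>
      simp only [Finset.range_zero, Finset.sum_empty, zero_add, hD]
      refine lintegral_congr_ae ?_
      filter_upwards [hp] with s hs
      simp [div_self (hs.residualMass_pos n).ne', bringForward]
    | succ m ih => rw [ih, hstep m, Finset.sum_range_succ, add_assoc]
  have hD0 : Tendsto D atTop (𝓝 0) := by
    have := tendsto_lintegral_of_dominated_convergence (μ := μ)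
      (F := fun m s => ENNReal.ofReal (residualMass s (n + m) / residualMass s n)
        * F (s ∘ bringForward n m)) (f := fun _ => 0) (fun _ => 1)
      (fun m => by have := hFm m; fun_prop) (fun m => ?_) (by simp) ?_
    · simpa using this
    · filter_upwards [hp] with s hs
      refine mul_le_one' ?_ (hF1 _)
      rw [ENNReal.ofReal_le_one, div_le_one (hs.residualMass_pos n)]
      exact hs.residualMass_antitone (Nat.le_add_right n m)
    · filter_upwards [hp] with s hs
      have h1 : Tendsto (fun m => residualMass s (n + m) / residualMass s n) atTop (𝓝 0) := by
        have := ((tendsto_residualMass hs.hasSum).comp (tendsto_add_atTop_nat n)).div_const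
          (residualMass s n)
        simpa [Function.comp_def, add_comm] using this
      have h2 := ENNReal.tendsto_ofReal h1
      rw [ENNReal.ofReal_zero] at h2
      exact tendsto_of_tendsto_of_tendsto_of_le_of_le tendsto_const_nhds h2 (fun _ => zero_le)
        fun m => mul_le_of_le_one_right' (hF1 _)
  have hlim := (ENNReal.tendsto_nat_tsum fun k =>
    ∫⁻ s, pickWeight n k s * F (s ∘ bringForward n k) ∂μ).add hD0
  rw [add_zero] at hlim
  exact tendsto_nhds_unique hlim (tendsto_const_nhds.congr hsum)

/-- The weights `pickWeight n m s`, replaced by the point mass at `m = 0` when they are not a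
probability, so that the kernel built from them is Markov everywhere. -/
noncomputable def pickProb (n m : ℕ) (s : ℕ → ℝ) : ENNReal :=
  open scoped Classical in
  if ∑' k, pickWeight n k s = 1 then pickWeight n m s else if m = 0 then 1 else 0

lemma measurable_pickProb (n m : ℕ) : Measurable (pickProb n m) := by
  unfold pickProb
  refine Measurable.ite (measurableSet_eq_fun
    (Measurable.tsum fun k => measurable_pickWeight n k) measurable_const)
    (measurable_pickWeight n m) measurable_const

lemma tsum_pickProb (n : ℕ) (s : ℕ → ℝ) : ∑' m, pickProb n m s = 1 := by
  unfold pickProb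
  by_cases h : ∑' k, pickWeight n k s = 1
  · simp only [h, if_true]
  · simp [h]

lemma IsProperWeights.pickProb_eq {s : ℕ → ℝ} (hs : IsProperWeights s) (n m : ℕ) :
    pickProb n m s = pickWeight n m s := if_pos (hs.tsum_pickWeight n)

/-- The Markov kernel that makes a size-biased pick among the positions `≥ n` and moves the weight
picked to the position `n`. -/
noncomputable def pickKernel (n : ℕ) : Kernel (ℕ → ℝ) (ℕ → ℝ) where
  toFun s := Measure.sum fun m => pickProb n m s • Measure.dirac (s ∘ bringForward n m)
  measurable' := by
    refine Measure.measurable_of_measurable_coe _ fun A hA => ?_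
    have e : (fun s : ℕ → ℝ => Measure.sum (fun m =>
        pickProb n m s • Measure.dirac (s ∘ bringForward n m)) A)
        = fun s => ∑' m, pickProb n m s * A.indicator 1 (s ∘ bringForward n m) := by
      funext s
      simp [Measure.sum_apply _ hA, Measure.dirac_apply' _ hA]
    rw [e]
    exact Measurable.tsum fun m => (measurable_pickProb n m).mul
      ((measurable_one.indicator hA).comp (measurable_comp_perm _))

lemma pickKernel_apply (n : ℕ) (s : ℕ → ℝ) {A : Set (ℕ → ℝ)} (hA : MeasurableSet A) :
    pickKernel n s A = ∑' m, pickProb n m s * A.indicator 1 (s ∘ bringForward n m) := by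
  change Measure.sum _ A = _
  simp [Measure.sum_apply _ hA, Measure.dirac_apply' _ hA]

instance (n : ℕ) : IsMarkovKernel (pickKernel n) :=
  ⟨fun s => ⟨by simp [pickKernel_apply n s MeasurableSet.univ, tsum_pickProb]⟩⟩

lemma IsAdjacentSwapInvariant.lintegral_pickKernel {μ : Measure (ℕ → ℝ)}
    [IsProbabilityMeasure μ] (hμ : IsAdjacentSwapInvariant μ) (hp : ∀ᵐ s ∂μ, IsProperWeights s)
    (n : ℕ) {A : Set (ℕ → ℝ)} (hA : MeasurableSet A) :
    ∫⁻ s, pickKernel n s A ∂μ = μ A := by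
  have h1 : Measurable (A.indicator (1 : (ℕ → ℝ) → ENNReal)) := measurable_one.indicator hA
  have := hμ.tsum_lintegral_pickWeight hp n h1
    (fun s => Set.indicator_le_self' (fun _ _ => zero_le) s)
  rw [lintegral_indicator_one hA] at this
  rw [← this, ← lintegral_tsum fun m => by
    have := h1.comp (measurable_comp_perm (bringForward n m))
    exact ((measurable_pickWeight n m).mul this).aemeasurable]
  refine lintegral_congr_ae ?_
  filter_upwards [hp] with s hs
  rw [pickKernel_apply n s hA]
  simp only [hs.pickProb_eq]

/-! ### The conditional law of the next pick -/

/-- The weights, together with the first `n` picks; the later picks are replaced by `0`. -/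
def pastPicks (n : ℕ) (q : (ℕ → ℝ) × (ℕ → ℝ)) : (ℕ → ℝ) × (ℕ → ℝ) :=
  (q.1, fun i => if i < n then q.2 i else 0)

open scoped Classical in
/-- The conditional probability that a size-biased permutation picks the weight `q.1 j` at the
step `n`, given the weights `q.1` and the first `n` entries of `q.2`. -/
noncomputable def pickRatio (n j : ℕ) (q : (ℕ → ℝ) × (ℕ → ℝ)) : ℝ :=
  if ∃ i < n, q.1 j = q.2 i then 0 else q.1 j / (1 - ∑ i ∈ Finset.range n, q.2 i)

@[fun_prop]
lemma measurable_pastPicks (n : ℕ) : Measurable (pastPicks n) := by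
  refine measurable_fst.prodMk (measurable_pi_lambda _ fun i => ?_)
  by_cases h : i < n <;> simp only [h, if_true, if_false] <;> fun_prop

@[fun_prop]
lemma measurable_pickRatio (n j : ℕ) : Measurable (pickRatio n j) := by
  classical
  unfold pickRatio
  refine Measurable.ite ?_ measurable_const (by fun_prop)
  have : {q : (ℕ → ℝ) × (ℕ → ℝ) | ∃ i < n, q.1 j = q.2 i}
      = ⋃ i, ⋃ (_ : i < n), {q | q.1 j = q.2 i} := by
    ext q
    simp
  rw [this]
  exact MeasurableSet.iUnion fun i => MeasurableSet.iUnion fun _ =>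
    measurableSet_eq_fun (by fun_prop) (by fun_prop)

lemma pickRatio_pastPicks (n j : ℕ) (q : (ℕ → ℝ) × (ℕ → ℝ)) :
    pickRatio n j (pastPicks n q) = pickRatio n j q := by
  have h1 : (∃ i < n, (pastPicks n q).1 j = (pastPicks n q).2 i) ↔ ∃ i < n, q.1 j = q.2 i :=
    exists_congr fun i => and_congr_right fun hi => by simp [pastPicks, hi]
  have h2 : ∑ i ∈ Finset.range n, (pastPicks n q).2 i = ∑ i ∈ Finset.range n, q.2 i :=
    Finset.sum_congr rfl fun i hi => if_pos (Finset.mem_range.1 hi)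
  unfold pickRatio
  rw [h2]
  by_cases h : ∃ i < n, q.1 j = q.2 i
  · rw [if_pos h, if_pos (h1.2 h)]
  · rw [if_neg h, if_neg fun h' => h (h1.1 h')]
    rfl

lemma sup_comap_eq_comap_pastPicks (n : ℕ) :
    ((⨆ k, MeasurableSpace.comap (fun q : (ℕ → ℝ) × (ℕ → ℝ) => q.1 k) inferInstance) ⊔
      ⨆ i ∈ Finset.range n,
        MeasurableSpace.comap (fun q : (ℕ → ℝ) × (ℕ → ℝ) => q.2 i) inferInstance)
      = MeasurableSpace.comap (pastPicks n) inferInstance := by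
  apply le_antisymm
  · refine sup_le (iSup_le fun k => ?_) (iSup₂_le fun i hi => ?_)
    · rw [← measurable_iff_comap_le]
      have : (fun q : (ℕ → ℝ) × (ℕ → ℝ) => q.1 k)
          = (fun p : (ℕ → ℝ) × (ℕ → ℝ) => p.1 k) ∘ pastPicks n := rfl
      rw [this]
      exact Measurable.comp (by fun_prop) (comap_measurable _)
    · rw [← measurable_iff_comap_le]
      have : (fun q : (ℕ → ℝ) × (ℕ → ℝ) => q.2 i)
          = (fun p : (ℕ → ℝ) × (ℕ → ℝ) => p.2 i) ∘ pastPicks n := by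
        funext q
        simp [pastPicks, Finset.mem_range.1 hi]
      rw [this]
      exact Measurable.comp (by fun_prop) (comap_measurable _)
  · rw [← measurable_iff_comap_le]
    refine Measurable.prodMk ?_ ?_
    · refine @measurable_pi_lambda _ _ _ (_) _ _ fun k => ?_
      rw [measurable_iff_comap_le]
      exact (le_iSup (fun k => MeasurableSpace.comap
        (fun q : (ℕ → ℝ) × (ℕ → ℝ) => q.1 k) inferInstance) k).trans le_sup_left
    · refine @measurable_pi_lambda _ _ _ (_) _ _ fun i => ?_
      by_cases hi : i < n
      · simp only [hi, if_true]
        rw [measurable_iff_comap_le]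
        exact (le_iSup₂ (f := fun i (_ : i ∈ Finset.range n) => MeasurableSpace.comap
          (fun q : (ℕ → ℝ) × (ℕ → ℝ) => q.2 i) inferInstance) i
          (Finset.mem_range.2 hi)).trans le_sup_right
      · simp only [hi, if_false]
        exact measurable_const

/-- The conditional probabilities of a size-biased permutation, in integrated form. -/
lemma condExp_ae_eq_pickRatio_iff (Q : Measure ((ℕ → ℝ) × (ℕ → ℝ))) [IsProbabilityMeasure Q]
    (n j : ℕ) :
    Q⟦{q | q.2 n = q.1 j} | MeasurableSpace.comap (pastPicks n) inferInstance⟧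
        =ᵐ[Q] pickRatio n j ↔
      (∀ᵐ q ∂Q, 0 ≤ pickRatio n j q) ∧ ∀ C : Set ((ℕ → ℝ) × (ℕ → ℝ)), MeasurableSet C →
        Q (pastPicks n ⁻¹' C ∩ {q | q.2 n = q.1 j})
          = ∫⁻ q in pastPicks n ⁻¹' C, ENNReal.ofReal (pickRatio n j q) ∂Q := by
  have hm : MeasurableSpace.comap (pastPicks n) inferInstance
      ≤ (inferInstance : MeasurableSpace ((ℕ → ℝ) × (ℕ → ℝ))) := (measurable_pastPicks n).comap_le
  have hE : MeasurableSet {q : (ℕ → ℝ) × (ℕ → ℝ) | q.2 n = q.1 j} :=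
    measurableSet_eq_fun (by fun_prop) (by fun_prop)
  have hE1 : Integrable ({q : (ℕ → ℝ) × (ℕ → ℝ) | q.2 n = q.1 j}.indicator fun _ => (1 : ℝ)) Q :=
    (integrable_const _).indicator hE
  have hreal : ∀ B : Set ((ℕ → ℝ) × (ℕ → ℝ)),
      ∫ q in B, {q : (ℕ → ℝ) × (ℕ → ℝ) | q.2 n = q.1 j}.indicator (fun _ => (1 : ℝ)) q ∂Q
        = Q.real (B ∩ {q | q.2 n = q.1 j}) := fun B => by
    rw [setIntegral_indicator hE, setIntegral_const, smul_eq_mul, mul_one]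
  constructor
  · intro h
    have h0 : ∀ᵐ q ∂Q, 0 ≤ pickRatio n j q := by
      filter_upwards [h, condExp_nonneg (μ := Q) (m := MeasurableSpace.comap (pastPicks n)
        inferInstance) (Eventually.of_forall fun q => Set.indicator_nonneg
          (s := {q : (ℕ → ℝ) × (ℕ → ℝ) | q.2 n = q.1 j}) (f := fun _ => (1 : ℝ))
          (fun _ _ => zero_le_one) q)] with q h1 h2
      rw [← h1]
      exact h2
    refine ⟨h0, fun C hC => ?_⟩
    have hi : Integrable (pickRatio n j) Q := integrable_condExp.congr h
    rw [← ofReal_integral_eq_lintegral_ofReal hi.integrableOn (ae_restrict_of_ae h0),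
      ← setIntegral_congr_ae (measurable_pastPicks n hC) (h.mono fun q hq _ => hq),
      setIntegral_condExp hm hE1 ⟨C, hC, rfl⟩, hreal, ofReal_measureReal]
  · rintro ⟨h0, h⟩
    have hi : Integrable (pickRatio n j) Q := by
      refine ⟨(measurable_pickRatio n j).aestronglyMeasurable, ?_⟩
      rw [hasFiniteIntegral_iff_ofReal h0]
      have := h Set.univ MeasurableSet.univ
      rw [Set.preimage_univ, Measure.restrict_univ] at this
      rw [← this]
      exact measure_lt_top _ _
    refine (ae_eq_condExp_of_forall_setIntegral_eq hm hE1 (fun _ _ _ => hi.integrableOn) ?_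
      ?_).symm
    · rintro _ ⟨C, hC, rfl⟩ _
      rw [hreal, Measure.real, h C hC, integral_eq_lintegral_of_nonneg_ae (ae_restrict_of_ae h0)
        (measurable_pickRatio n j).aestronglyMeasurable]
    · have e : pickRatio n j = pickRatio n j ∘ pastPicks n := by
        funext q
        exact (pickRatio_pastPicks n j q).symm
      rw [e]
      exact (Measurable.comp (measurable_pickRatio n j)
        (comap_measurable _)).stronglyMeasurable.aestronglyMeasurable

/-! ### Uniqueness in law of size-biased permutations -/

lemma measure_eq_of_map_pastPicks {Q Q' : Measure ((ℕ → ℝ) × (ℕ → ℝ))} [IsProbabilityMeasure Q]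
    [IsProbabilityMeasure Q'] (h : ∀ n, Q.map (pastPicks n) = Q'.map (pastPicks n)) :
    Q.map Prod.snd = Q'.map Prod.snd := by
  have : IsProbabilityMeasure (Q.map Prod.snd) :=
    Measure.isProbabilityMeasure_map measurable_snd.aemeasurable
  refine IsProjectiveLimit.unique (P := fun I => (Q.map Prod.snd).map I.restrict)
    (fun _ => rfl) fun I => ?_
  have key : ∀ ν : Measure ((ℕ → ℝ) × (ℕ → ℝ)), (ν.map Prod.snd).map I.restrict
      = (ν.map (pastPicks (I.sup id + 1))).map fun q => I.restrict q.2 := by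
    intro ν
    rw [Measure.map_map (by fun_prop) measurable_snd, Measure.map_map (by fun_prop) (by fun_prop)]
    congr 1
    funext q
    ext i
    have : (i : ℕ) < I.sup id + 1 := Nat.lt_succ_of_le (Finset.le_sup (f := id) i.2)
    exact (if_pos this).symm
  simp only [key, h]

/-- Two couplings of the same weights with size-biased permutations of them have the same second
marginal: the conditional probabilities determine, step by step, the joint law of the weights and
of the first `n` picks. -/
theorem IsSizeBiasedCoupling.map_snd_eq {Ω : Type*} [MeasurableSpace Ω] {P : Measure Ω}
    {W : ℕ → Ω → ℝ} {Q Q' : Measure ((ℕ → ℝ) × (ℕ → ℝ))} (hQ : IsSizeBiasedCoupling P W Q)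
    (hQ' : IsSizeBiasedCoupling P W Q')
    (hinj : ∀ᵐ w ∂P.map (fun ω j => W j ω), Function.Injective w) :
    Q.map Prod.snd = Q'.map Prod.snd := by
  have := hQ.isProbabilityMeasure
  have := hQ'.isProbabilityMeasure
  refine measure_eq_of_map_pastPicks fun n => ?_
  -- The law of the first `n + 1` picks, in terms of the law of the first `n` picks.
  have key : ∀ ν : Measure ((ℕ → ℝ) × (ℕ → ℝ)), IsSizeBiasedCoupling P W ν → ∀ n,
      ∀ C : Set ((ℕ → ℝ) × (ℕ → ℝ)), MeasurableSet C → ν.map (pastPicks (n + 1)) C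
        = ∑' j, ∫⁻ q in (fun p : (ℕ → ℝ) × (ℕ → ℝ) =>
            (p.1, Function.update p.2 n (p.1 j))) ⁻¹' C,
          ENNReal.ofReal (pickRatio n j q) ∂ν.map (pastPicks n) := by
    intro ν hν n C hC
    have := hν.isProbabilityMeasure
    have hu : ∀ j, Measurable fun p : (ℕ → ℝ) × (ℕ → ℝ) =>
        (p.1, Function.update p.2 n (p.1 j)) := fun j => by
      refine measurable_fst.prodMk (measurable_pi_lambda _ fun i => ?_)
      by_cases h : i = n
      · subst h
        simp only [Function.update_self]
        fun_prop
      · simp only [Function.update_of_ne h]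
        fun_prop
    have hE : ∀ j, MeasurableSet {q : (ℕ → ℝ) × (ℕ → ℝ) | q.2 n = q.1 j} := fun j =>
      measurableSet_eq_fun (by fun_prop) (by fun_prop)
    have hνinj : ∀ᵐ q ∂ν, Function.Injective q.1 := by
      rw [← hν.map_fst] at hinj
      exact ae_of_ae_map measurable_fst.aemeasurable hinj
    rw [Measure.map_apply (measurable_pastPicks _) hC]
    have e : pastPicks (n + 1) ⁻¹' C =ᵐ[ν] ⋃ j, (pastPicks n ⁻¹' ((fun p : (ℕ → ℝ) × (ℕ → ℝ) =>
        (p.1, Function.update p.2 n (p.1 j))) ⁻¹' C) ∩ {q | q.2 n = q.1 j}) := by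
      have hup : ∀ (q : (ℕ → ℝ) × (ℕ → ℝ)) (j : ℕ), q.2 n = q.1 j → pastPicks (n + 1) q
          = (q.1, Function.update (pastPicks n q).2 n (q.1 j)) := fun q j hj => by
        refine Prod.ext rfl (funext fun i => ?_)
        rcases lt_trichotomy i n with h | h | h
        · simp [pastPicks, Function.update_of_ne h.ne, h, h.le]
        · subst h
          simp [pastPicks, hj]
        · simp [pastPicks, Function.update_of_ne h.ne', h.not_gt, h.not_ge]
      filter_upwards [hν.sizeBiased.perm] with q hq
      obtain ⟨π, hπ⟩ := hq
      apply propext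
      change pastPicks (n + 1) q ∈ C ↔ q ∈ ⋃ j, _
      simp only [Set.mem_iUnion]
      constructor
      · intro h
        refine ⟨π n, ?_, hπ n⟩
        rw [hup q _ (hπ n)] at h
        exact h
      · rintro ⟨j, h, hj⟩
        rw [hup q j hj]
        exact h
    rw [measure_congr e, measure_iUnion₀]
    · refine tsum_congr fun j => ?_
      have hc := hν.sizeBiased.cond n j
      rw [sup_comap_eq_comap_pastPicks] at hc
      rw [((condExp_ae_eq_pickRatio_iff ν n j).1 hc).2 _ (hu j hC),
        setLIntegral_map (hu j hC) (measurable_pickRatio n j).ennreal_ofReal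
          (measurable_pastPicks n)]
      simp only [pickRatio_pastPicks]
    · intro j k hjk
      change ν (_ ∩ _) = 0
      refine measure_mono_null ?_ (ae_iff.1 hνinj)
      rintro q ⟨⟨_, h1⟩, ⟨_, h2⟩⟩ hinj
      exact hjk (hinj (h1.symm.trans h2))
    · intro j
      exact ((measurable_pastPicks n (hu j hC)).inter (hE j)).nullMeasurableSet
  induction n with
  | zero =>
    have e : ∀ ν : Measure ((ℕ → ℝ) × (ℕ → ℝ)), ν.map (pastPicks 0)
        = (ν.map Prod.fst).map fun w => (w, fun _ => 0) := fun ν => by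
      rw [Measure.map_map (by fun_prop) measurable_fst]
      rfl
    rw [e, e, hQ.map_fst, hQ'.map_fst]
  | succ n ih =>
    ext C hC
    rw [key Q hQ n C hC, key Q' hQ' n C hC, ih]

/-! ### Construction of a size-biased permutation -/

/-- The law of the Markov chain of sequences started from the law `μ`, in which the transition from
the sequence number `n` to the sequence number `n + 1` is `pickKernel n`. The entry number `n` of
the sequence number `n + 1` is the `n`-th size-biased pick, and keeps its place from then on. -/
noncomputable def pickChain (μ : Measure (ℕ → ℝ)) : Measure (ℕ → ℕ → ℝ) :=
  Kernel.trajMeasure (X := fun _ => ℕ → ℝ) μ fun n =>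
    (pickKernel n).comap (fun h : (Finset.Iic n → ℕ → ℝ) => h ⟨n, Finset.mem_Iic.2 le_rfl⟩)
      (by fun_prop)

/-- The picks made along a path of the chain `pickChain`. -/
def chainPicks (S : ℕ → ℕ → ℝ) (n : ℕ) : ℝ := S (n + 1) n

@[fun_prop]
lemma measurable_chainPicks : Measurable chainPicks := by
  unfold chainPicks
  fun_prop

section PickChain

variable {μ : Measure (ℕ → ℝ)}

lemma pickChain_map_zero : (pickChain μ).map (fun S => S 0) = μ := by
  have e : (fun S : ℕ → ℕ → ℝ => S 0)
      = (fun h : (Finset.Iic 0 → ℕ → ℝ) => h ⟨0, Finset.mem_Iic.2 le_rfl⟩)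
        ∘ Preorder.frestrictLe (π := fun _ => ℕ → ℝ) 0 := rfl
  rw [e, ← Measure.map_map (by fun_prop) (by fun_prop), pickChain, Kernel.trajMeasure,
    Measure.map_comp _ _ (by fun_prop), Kernel.traj_map_frestrictLe, Kernel.partialTraj_self,
    Measure.id_comp, Measure.map_map (by fun_prop) (by fun_prop)]
  exact Measure.map_id

variable [IsProbabilityMeasure μ]

instance : IsProbabilityMeasure (pickChain μ) := by
  unfold pickChain
  infer_instance

/-- The Markov property of the chain `pickChain`, in integrated form. -/
lemma pickChain_apply (n : ℕ) {C : Set ((Finset.Iic n → ℕ → ℝ) × (ℕ → ℝ))}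
    (hC : MeasurableSet C) :
    pickChain μ {S | (Preorder.frestrictLe (π := fun _ => ℕ → ℝ) n S, S (n + 1)) ∈ C}
      = ∫⁻ S, pickKernel n (S n) {s | (Preorder.frestrictLe (π := fun _ => ℕ → ℝ) n S, s) ∈ C}
          ∂pickChain μ := by
  have h := congrArg (fun ν => ν C) (Kernel.map_frestrictLe_trajMeasure_compProd_eq_map_trajMeasure
    (X := fun _ => ℕ → ℝ) (μ₀ := μ) (a := n) (κ := fun n =>
      (pickKernel n).comap (fun h : (Finset.Iic n → ℕ → ℝ) => h ⟨n, Finset.mem_Iic.2 le_rfl⟩)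
      (by fun_prop)))
  beta_reduce at h
  rw [Measure.compProd_apply hC, Measure.map_apply (by fun_prop) hC,
    lintegral_map (Kernel.measurable_kernel_prodMk_left hC) (by fun_prop)] at h
  exact h.symm

lemma pickChain_map_eval (hμ : IsAdjacentSwapInvariant μ) (hp : ∀ᵐ s ∂μ, IsProperWeights s)
    (n : ℕ) : (pickChain μ).map (fun S => S n) = μ := by
  induction n with
  | zero => exact pickChain_map_zero
  | succ n ih =>
    ext A hA
    rw [Measure.map_apply (by fun_prop) hA]
    have h := pickChain_apply (μ := μ) n (measurable_snd hA)
    refine h.trans ?_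
    change ∫⁻ S, pickKernel n (S n) A ∂pickChain μ = _
    rw [← lintegral_map (f := fun s => pickKernel n s A) (g := fun S : ℕ → ℕ → ℝ => S n)
      ((pickKernel n).measurable_coe hA) (by fun_prop), ih, hμ.lintegral_pickKernel hp n hA]

lemma ae_pickChain_isProperWeights (hμ : IsAdjacentSwapInvariant μ)
    (hp : ∀ᵐ s ∂μ, IsProperWeights s) : ∀ᵐ S ∂pickChain μ, ∀ n, IsProperWeights (S n) := by
  refine ae_all_iff.2 fun n => ?_
  rw [← pickChain_map_eval hμ hp n] at hp
  exact ae_of_ae_map (measurable_pi_apply n).aemeasurable hp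

lemma ae_pickChain_step :
    ∀ᵐ S ∂pickChain μ, ∀ n, ∃ m, S (n + 1) = S n ∘ bringForward n m := by
  refine ae_all_iff.2 fun n => ?_
  have hC : MeasurableSet {q : (Finset.Iic n → ℕ → ℝ) × (ℕ → ℝ) |
      ∃ m, q.2 = q.1 ⟨n, Finset.mem_Iic.2 le_rfl⟩ ∘ bringForward n m} := by
    rw [Set.ofPred_exists]
    refine MeasurableSet.iUnion fun m => measurableSet_eq_fun measurable_snd ?_
    exact (measurable_comp_perm (bringForward n m)).comp (by fun_prop)
  have h := pickChain_apply (μ := μ) n hC.compl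
  rw [ae_iff]
  refine h.trans ?_
  refine (lintegral_congr fun S => ?_).trans lintegral_zero
  have hm : MeasurableSet {s : ℕ → ℝ | ¬ ∃ m, s = S n ∘ bringForward n m} := by
    simp only [not_exists, Set.ofPred_forall]
    exact MeasurableSet.iInter fun m => (measurableSet_eq_fun measurable_id measurable_const).compl
  refine (pickKernel_apply n (S n) hm).trans (ENNReal.tsum_eq_zero.2 fun m => ?_)
  rw [Set.indicator_of_notMem, mul_zero]
  exact fun hc => hc ⟨m, rfl⟩

end PickChain

section Path

variable {S : ℕ → ℕ → ℝ}

/-- The first `n` entries of the sequence number `n` are the first `n` picks. -/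
lemma path_eq_chainPicks (hS : ∀ n, ∃ m, S (n + 1) = S n ∘ bringForward n m) {i n : ℕ}
    (hi : i < n) : S n i = chainPicks S i := by
  induction n, Nat.succ_le_of_lt hi using Nat.le_induction with
  | base => rfl
  | succ n hn ih =>
    obtain ⟨m, hm⟩ := hS n
    rw [hm, Function.comp_apply, bringForward_of_lt hn]
    exact ih hn

lemma path_eq_comp_perm (hS : ∀ n, ∃ m, S (n + 1) = S n ∘ bringForward n m) (n : ℕ) :
    ∃ π : Equiv.Perm ℕ, S n = S 0 ∘ π := by
  induction n with
  | zero => exact ⟨1, rfl⟩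
  | succ n ih =>
    obtain ⟨π, hπ⟩ := ih
    obtain ⟨m, hm⟩ := hS n
    exact ⟨π * bringForward n m, by rw [hm, hπ]; rfl⟩

/-- Proper weights `w'` that are all found among the proper weights `w` exhaust them: a weight left
out would make the sum of `w'` less than one. -/
lemma IsProperWeights.exists_perm {w w' : ℕ → ℝ} (hw : IsProperWeights w)
    (hw' : IsProperWeights w') (h : ∀ n, ∃ j, w' n = w j) :
    ∃ π : Equiv.Perm ℕ, ∀ n, w' n = w (π n) := by
  choose f hf using h
  have hinj : Function.Injective f := fun a b hab => hw'.injective (by rw [hf, hf, hab])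
  have hsurj : Function.Surjective f := by
    intro j
    by_contra hj
    have hsum : HasSum (w ∘ f) 1 := by
      have : w' = w ∘ f := funext hf
      rw [← this]
      exact hw'.hasSum
    have h1 := (Function.Injective.hasSum_iff (f := (Set.range f).indicator w) hinj
      (fun x hx => Set.indicator_of_notMem hx w)).1
      (by convert hsum using 1; ext n; simp)
    have h2 := h1.add (hasSum_ite_eq j (w j))
    have h3 := hasSum_le (fun k => ?_) h2 hw.hasSum
    · linarith [hw.pos j]
    · by_cases hk : k = j
      · subst hk
        have hk' : k ∉ Set.range f := hj
        rw [Set.indicator_of_notMem hk']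
        simp
      · simp only [hk, if_false, add_zero]
        exact Set.indicator_le_self' (fun k _ => (hw.pos k).le) k
  exact ⟨Equiv.ofBijective f ⟨hinj, hsurj⟩, hf⟩

/-- Along a path of the chain, the transition probabilities are the conditional probabilities that
define a size-biased permutation: the weight at the original position `j` sits at some position `k`
of the current sequence, and has been picked already if and only if `k < n`. -/
lemma pickKernel_setOf_eq (hS : ∀ n, ∃ m, S (n + 1) = S n ∘ bringForward n m)
    (hp : ∀ n, IsProperWeights (S n)) (n j : ℕ) :
    pickKernel n (S n) {s | s n = S 0 j} = ENNReal.ofReal (pickRatio n j (S 0, chainPicks S)) := by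
  obtain ⟨π, hπ⟩ := path_eq_comp_perm hS n
  obtain ⟨k, rfl⟩ := π.surjective j
  have hk : S 0 (π k) = S n k := by rw [hπ]; rfl
  have hm : MeasurableSet {s : ℕ → ℝ | s n = S 0 (π k)} :=
    measurableSet_eq_fun (by fun_prop) measurable_const
  rw [pickKernel_apply n (S n) hm]
  have hind : ∀ m, ({s : ℕ → ℝ | s n = S 0 (π k)}.indicator 1 (S n ∘ bringForward n m) : ENNReal)
      = if n + m = k then 1 else 0 := fun m => by
    have : (S n ∘ bringForward n m ∈ {s : ℕ → ℝ | s n = S 0 (π k)}) ↔ n + m = k := by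
      change S n (bringForward n m n) = _ ↔ _
      rw [bringForward_self, hk, (hp n).injective.eq_iff]
    rw [Set.indicator_apply, if_congr this rfl rfl, Pi.one_apply]
  simp only [hind, (hp n).pickProb_eq]
  have hex : (∃ i < n, S 0 (π k) = chainPicks S i) ↔ k < n := by
    constructor
    · rintro ⟨i, hi, h⟩
      rw [hk, ← path_eq_chainPicks hS hi] at h
      rwa [(hp n).injective h]
    · exact fun h => ⟨k, h, by rw [hk, path_eq_chainPicks hS h]⟩
  unfold pickRatio
  by_cases h : k < n
  · rw [if_pos (hex.2 h), ENNReal.ofReal_zero, ENNReal.tsum_eq_zero]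
    intro m
    rw [if_neg (by lia), mul_zero]
  · rw [if_neg fun h' => h (hex.1 h')]
    obtain ⟨m, rfl⟩ := Nat.exists_eq_add_of_le (Nat.not_lt.1 h)
    rw [tsum_eq_single m fun m' hm' => by rw [if_neg (by lia), mul_zero], if_pos rfl, mul_one,
      pickWeight, ← hk, residualMass]
    congr 3
    exact Finset.sum_congr rfl fun i hi => path_eq_chainPicks hS (Finset.mem_range.1 hi)

end Path

section Coupling

variable {μ : Measure (ℕ → ℝ)}

/-- The joint law of the initial sequence of the chain `pickChain` and of the picks. -/
noncomputable def pickCoupling (μ : Measure (ℕ → ℝ)) : Measure ((ℕ → ℝ) × (ℕ → ℝ)) :=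
  (pickChain μ).map fun S => (S 0, chainPicks S)

lemma measurable_initial_chainPicks :
    Measurable fun S : ℕ → ℕ → ℝ => (S 0, chainPicks S) := by
  fun_prop

lemma pickCoupling_map_fst : (pickCoupling μ).map Prod.fst = μ := by
  rw [pickCoupling, Measure.map_map measurable_fst measurable_initial_chainPicks]
  exact pickChain_map_zero

variable [IsProbabilityMeasure μ]

lemma pickChain_map_chainPicks (hμ : IsAdjacentSwapInvariant μ)
    (hp : ∀ᵐ s ∂μ, IsProperWeights s) : (pickChain μ).map chainPicks = μ := by
  refine IsProjectiveLimit.unique (P := fun I => μ.map I.restrict) (fun I => ?_) fun _ => rfl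
  simp only
  rw [Measure.map_map (by fun_prop) (by fun_prop)]
  conv_rhs => rw [← pickChain_map_eval hμ hp (I.sup id + 1)]
  rw [Measure.map_map (by fun_prop) (by fun_prop)]
  refine Measure.map_congr ?_
  filter_upwards [ae_pickChain_step (μ := μ)] with S hS
  ext i
  exact (path_eq_chainPicks hS (Nat.lt_succ_of_le (Finset.le_sup (f := id) i.2))).symm

lemma pickCoupling_map_snd (hμ : IsAdjacentSwapInvariant μ) (hp : ∀ᵐ s ∂μ, IsProperWeights s) :
    (pickCoupling μ).map Prod.snd = μ := by
  rw [pickCoupling, Measure.map_map measurable_snd measurable_initial_chainPicks]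
  exact pickChain_map_chainPicks hμ hp

/-- The picks satisfy the conditional probabilities of a size-biased permutation, in integrated
form. The past that is conditioned on is coarser than the past of the chain. -/
lemma pickCoupling_inter (hμ : IsAdjacentSwapInvariant μ) (hp : ∀ᵐ s ∂μ, IsProperWeights s)
    (n j : ℕ) {C : Set ((ℕ → ℝ) × (ℕ → ℝ))} (hC : MeasurableSet C) :
    pickCoupling μ (pastPicks n ⁻¹' C ∩ {q | q.2 n = q.1 j})
      = ∫⁻ q in pastPicks n ⁻¹' C, ENNReal.ofReal (pickRatio n j q) ∂pickCoupling μ := by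
  have hE : MeasurableSet {q : (ℕ → ℝ) × (ℕ → ℝ) | q.2 n = q.1 j} :=
    measurableSet_eq_fun (by fun_prop) (by fun_prop)
  have hB := measurable_pastPicks n hC
  -- The first `n` picks are read off from the first `n + 1` sequences of the chain.
  set r : (Finset.Iic n → ℕ → ℝ) → (ℕ → ℝ) × (ℕ → ℝ) := fun h =>
    (h ⟨0, Finset.mem_Iic.2 zero_le⟩,
      fun i => if hi : i < n then h ⟨i + 1, Finset.mem_Iic.2 hi⟩ i else 0) with hr
  have hrm : Measurable r := by
    refine Measurable.prodMk (by fun_prop) (measurable_pi_lambda _ fun i => ?_)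
    by_cases hi : i < n
    · simp only [hi, dif_pos]
      fun_prop
    · simp only [hi, dif_neg, not_false_iff]
      fun_prop
  have hrS : ∀ S : ℕ → ℕ → ℝ, r (Preorder.frestrictLe n S) = pastPicks n (S 0, chainPicks S) :=
    fun S => Prod.ext rfl (funext fun i => by
      by_cases hi : i < n <;> simp [hr, pastPicks, hi, chainPicks])
  have hD : MeasurableSet {p : (Finset.Iic n → ℕ → ℝ) × (ℕ → ℝ) |
      r p.1 ∈ C ∧ p.2 n = p.1 ⟨0, Finset.mem_Iic.2 zero_le⟩ j} :=
    ((hrm.comp measurable_fst) hC).inter (measurableSet_eq_fun (by fun_prop) (by fun_prop))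
  have h := pickChain_apply (μ := μ) n hD
  rw [pickCoupling, Measure.map_apply measurable_initial_chainPicks (hB.inter hE),
    setLIntegral_map hB (by fun_prop) measurable_initial_chainPicks,
    ← lintegral_indicator (measurable_initial_chainPicks hB)]
  have e : (fun S : ℕ → ℕ → ℝ => (S 0, chainPicks S)) ⁻¹' (pastPicks n ⁻¹' C ∩ {q | q.2 n = q.1 j})
      = {S | (Preorder.frestrictLe (π := fun _ => ℕ → ℝ) n S, S (n + 1)) ∈
        {p : (Finset.Iic n → ℕ → ℝ) × (ℕ → ℝ) |
        r p.1 ∈ C ∧ p.2 n = p.1 ⟨0, Finset.mem_Iic.2 zero_le⟩ j}} := by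
    ext S
    change (pastPicks n (S 0, chainPicks S) ∈ C ∧ _) ↔ (r (Preorder.frestrictLe n S) ∈ C ∧ _)
    rw [hrS]
    rfl
  rw [e, h]
  refine lintegral_congr_ae ?_
  filter_upwards [ae_pickChain_step (μ := μ), ae_pickChain_isProperWeights hμ hp] with S hS hpS
  change pickKernel n (S n) {s | r (Preorder.frestrictLe n S) ∈ C ∧ s n = S 0 j} = _
  rw [hrS]
  by_cases hc : pastPicks n (S 0, chainPicks S) ∈ C
  · rw [Set.indicator_of_mem (by exact hc), ← pickKernel_setOf_eq hS hpS n j]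
    simp only [hc, true_and]
  · rw [Set.indicator_of_notMem (by exact hc)]
    simp [hc]

/-- A law of proper weights that is invariant under the reweighted exchanges of adjacent positions
is the law of a size-biased ordered sequence. -/
theorem isSizeBiasedOrdered_of_isAdjacentSwapInvariant {Ω : Type*} [MeasurableSpace Ω]
    {P : Measure Ω} {W : ℕ → Ω → ℝ} (hW : P.map (fun ω j => W j ω) = μ)
    (hμ : IsAdjacentSwapInvariant μ) (hp : ∀ᵐ s ∂μ, IsProperWeights s) :
    IsSizeBiasedOrdered P W := by
  have hQ : IsProbabilityMeasure (pickCoupling μ) :=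
    Measure.isProbabilityMeasure_map measurable_initial_chainPicks.aemeasurable
  have h1 : ∀ᵐ q ∂pickCoupling μ, IsProperWeights q.1 :=
    ae_of_ae_map measurable_fst.aemeasurable (by rwa [pickCoupling_map_fst])
  have h2 : ∀ᵐ q ∂pickCoupling μ, IsProperWeights q.2 :=
    ae_of_ae_map measurable_snd.aemeasurable (by rwa [pickCoupling_map_snd hμ hp])
  have h3 : ∀ᵐ q ∂pickCoupling μ, ∀ n, ∃ j, q.2 n = q.1 j := by
    have hm : MeasurableSet {q : (ℕ → ℝ) × (ℕ → ℝ) | ∀ n, ∃ j, q.2 n = q.1 j} := by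
      simp only [Set.ofPred_forall, Set.ofPred_exists]
      exact MeasurableSet.iInter fun n => MeasurableSet.iUnion fun j =>
        measurableSet_eq_fun (by fun_prop) (by fun_prop)
    refine (ae_map_iff measurable_initial_chainPicks.aemeasurable hm).2 ?_
    filter_upwards [ae_pickChain_step (μ := μ)] with S hS n
    obtain ⟨π, hπ⟩ := path_eq_comp_perm hS (n + 1)
    exact ⟨π n, congrFun hπ n⟩
  have hcoupling : IsSizeBiasedCoupling P W (pickCoupling μ) := by
    refine ⟨hQ, pickCoupling_map_fst.trans hW.symm, ?_, ?_, ?_, ?_⟩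
    · intro j
      fun_prop
    · intro n
      fun_prop
    · filter_upwards [h1, h2, h3] with q hq1 hq2 hq3 using hq1.exists_perm hq2 hq3
    · intro n j
      rw [sup_comap_eq_comap_pastPicks]
      refine (condExp_ae_eq_pickRatio_iff _ n j).2 ⟨?_, fun C hC => pickCoupling_inter hμ hp n j hC⟩
      filter_upwards [h1, h2] with q hq1 hq2
      unfold pickRatio
      split_ifs
      · exact le_rfl
      · exact div_nonneg (hq1.pos j).le (hq2.residualMass_pos n).le
  refine ⟨⟨_, hcoupling⟩, fun Q hQ => ?_⟩
  rw [hQ.map_snd_eq hcoupling (hW ▸ hp.mono fun s hs => hs.injective), hW]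
  exact pickCoupling_map_snd hμ hp

end Coupling

/-! ### Beta chains without trials are independent sequences -/

lemma betaChainDensity_zero (θ p s : ℝ) : betaChainDensity 0 1 θ p s = betaPDFReal 1 θ s := by
  simp [betaChainDensity, binomialWeight]

lemma setIntegral_betaPDFReal {a b : ℝ} (ha : 0 < a) (hb : 0 < b) {A : Set ℝ}
    (hA : MeasurableSet A) : ∫ s in A, betaPDFReal a b s = (betaMeasure a b).real A := by
  rw [integral_eq_lintegral_of_nonneg_ae (Eventually.of_forall (betaPDFReal_nonneg ha hb))
    (measurable_betaPDFReal a b).aestronglyMeasurable, Measure.real, betaMeasure,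
    withDensity_apply _ hA]
  rfl

lemma IsBetaChain.map_eq_infinitePi {Ω : Type*} [MeasurableSpace Ω] {P : Measure Ω}
    [IsProbabilityMeasure P] {θ : ℝ} (hθ : 0 < θ) {V : ℕ → Ω → ℝ} (h : IsBetaChain P 0 1 θ V) :
    P.map (fun ω i => V i ω) = Measure.infinitePi fun _ : ℕ => betaMeasure 1 θ := by
  have := isProbabilityMeasureBeta one_pos hθ
  have hV : Measurable fun ω i => V i ω := measurable_pi_lambda _ h.measurable
  have hrange : ∀ (n : ℕ) (t : ℕ → Set ℝ), (∀ i, MeasurableSet (t i)) →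
      P {ω | ∀ i ∈ Finset.range n, V i ω ∈ t i} = ∏ i ∈ Finset.range n, betaMeasure 1 θ (t i) := by
    intro n t ht
    induction n with
    | zero => simp
    | succ n ih =>
      have e : {ω | ∀ i ∈ Finset.range (n + 1), V i ω ∈ t i}
          = {ω | ∀ i ∈ Finset.range n, V i ω ∈ t i} ∩ V n ⁻¹' t n := by
        ext ω
        simp only [Finset.mem_range, Nat.lt_succ_iff_lt_or_eq, or_imp, forall_and, forall_eq]
        rfl
      rw [e, Finset.prod_range_succ, ← ih]
      cases n with
      | zero => simp [← h.initial, Measure.map_apply (h.measurable 0) (ht 0)]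
      | succ n =>
        have hB : MeasurableSet[⨆ i ∈ Finset.range (n + 1),
            MeasurableSpace.comap (V i) inferInstance]
            {ω | ∀ i ∈ Finset.range (n + 1), V i ω ∈ t i} := by
          simp only [Set.ofPred_forall]
          refine MeasurableSet.iInter fun i => MeasurableSet.iInter fun hi => ?_
          exact le_iSup₂ (f := fun i (_ : i ∈ Finset.range (n + 1)) =>
            MeasurableSpace.comap (V i) inferInstance) i hi _ ⟨t i, ht i, rfl⟩
        rw [← ofReal_measureReal, h.real_inter_preimage n hB (ht (n + 1))]
        simp only [betaChainDensity_zero]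
        rw [setIntegral_betaPDFReal one_pos hθ (ht (n + 1)), setIntegral_const, smul_eq_mul,
          ENNReal.ofReal_mul measureReal_nonneg, ofReal_measureReal, ofReal_measureReal]
  refine Measure.eq_infinitePi _ fun s t ht => ?_
  classical
  have hs : s ⊆ Finset.range (s.sup id + 1) := fun i hi =>
    Finset.mem_range.2 (Nat.lt_succ_of_le (Finset.le_sup (f := id) hi))
  have h1 := hrange (s.sup id + 1) (fun i => if i ∈ s then t i else Set.univ) fun i => by
    split_ifs
    exacts [ht i, MeasurableSet.univ]
  rw [Measure.map_apply hV (MeasurableSet.pi s.countable_toSet fun i _ => ht i)]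
  have e1 : (fun ω i => V i ω) ⁻¹' Set.pi s t = {ω | ∀ i ∈ Finset.range (s.sup id + 1),
      V i ω ∈ if i ∈ s then t i else Set.univ} := by
    ext ω
    refine ⟨fun hω i _ => ?_, fun hω i hi => ?_⟩
    · split_ifs with hi
      exacts [hω i hi, Set.mem_univ _]
    · have := hω i (hs hi)
      rwa [if_pos (Finset.mem_coe.1 hi)] at this
  rw [e1, h1, ← Finset.prod_subset hs]
  · exact Finset.prod_congr rfl fun i hi => by rw [if_pos hi]
  · intro i _ hi
    rw [if_neg hi, measure_univ]

/-! ### Splitting off the first term of an independent sequence -/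

/-- The sequence `a, v 0, v 1, …`. -/
def seqCons (a : ℝ) (v : ℕ → ℝ) : ℕ → ℝ
  | 0 => a
  | n + 1 => v n

@[simp] lemma seqCons_zero (a : ℝ) (v : ℕ → ℝ) : seqCons a v 0 = a := rfl

@[simp] lemma seqCons_succ (a : ℝ) (v : ℕ → ℝ) (n : ℕ) : seqCons a v (n + 1) = v n := rfl

@[fun_prop]
lemma Measurable.seqCons {α : Type*} [MeasurableSpace α] {f : α → ℝ} {g : α → ℕ → ℝ}
    (hf : Measurable f) (hg : Measurable g) : Measurable fun x => seqCons (f x) (g x) :=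
  measurable_pi_lambda _ fun n => by
    cases n with
    | zero => exact hf
    | succ n => exact (measurable_pi_apply n).comp hg

lemma smul_seqCons (c a : ℝ) (v : ℕ → ℝ) : c • seqCons a v = seqCons (c * a) (c • v) := by
  funext n
  cases n <;> rfl

lemma seqCons_comp_swap_succ (a : ℝ) (v : ℕ → ℝ) (m : ℕ) :
    seqCons a v ∘ Equiv.swap (m + 1) (m + 2) = seqCons a (v ∘ Equiv.swap m (m + 1)) := by
  funext n
  cases n with
  | zero =>
    rw [Function.comp_apply, Equiv.swap_apply_of_ne_of_ne (by lia) (by lia)]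
    rfl
  | succ n =>
    simp only [Function.comp_apply, seqCons_succ, Equiv.swap_apply_def]
    split_ifs <;> first | rfl | lia

lemma seqCons_seqCons_comp_swap (a b : ℝ) (v : ℕ → ℝ) :
    seqCons a (seqCons b v) ∘ Equiv.swap 0 1 = seqCons b (seqCons a v) := by
  funext n
  match n with
  | 0 => rfl
  | 1 => rfl
  | n + 2 =>
    rw [Function.comp_apply, Equiv.swap_apply_of_ne_of_ne (by lia) (by lia)]
    rfl

lemma infinitePi_map_seqCons (β : Measure ℝ) [IsProbabilityMeasure β] :
    (β.prod (Measure.infinitePi fun _ : ℕ => β)).map (fun p => seqCons p.1 p.2)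
      = Measure.infinitePi fun _ : ℕ => β := by
  refine Measure.eq_infinitePi _ fun s t ht => ?_
  classical
  have hm : Measurable fun p : ℝ × (ℕ → ℝ) => seqCons p.1 p.2 := by fun_prop
  rw [Measure.map_apply hm (MeasurableSet.pi s.countable_toSet fun i _ => ht i)]
  set s' : Finset ℕ := s.preimage Nat.succ Nat.succ_injective.injOn with hs'
  have e : (fun p : ℝ × (ℕ → ℝ) => seqCons p.1 p.2) ⁻¹' Set.pi s t
      = (if 0 ∈ s then t 0 else Set.univ) ×ˢ Set.pi s' fun i => t (i + 1) := by
    ext p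
    simp only [Set.mem_preimage, Set.mem_pi, Set.mem_prod, Finset.mem_coe, hs', Finset.mem_preimage]
    constructor
    · intro h
      refine ⟨?_, fun i hi => h (i + 1) hi⟩
      split_ifs with h0
      exacts [h 0 h0, Set.mem_univ _]
    · rintro ⟨h0, h1⟩ i hi
      cases i with
      | zero => rwa [if_pos hi] at h0
      | succ i => exact h1 i hi
  rw [e, Measure.prod_prod, Measure.infinitePi_pi _ fun i _ => ht (i + 1)]
  have e2 : ∏ i ∈ s', β (t (i + 1)) = ∏ i ∈ s.erase 0, β (t i) := by
    refine Finset.prod_bij (fun i _ => i + 1) ?_ ?_ ?_ ?_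
    · intro i hi
      exact Finset.mem_erase.2 ⟨Nat.succ_ne_zero i, by simpa [hs'] using hi⟩
    · intro i _ j _ hij
      exact Nat.succ_injective hij
    · intro i hi
      obtain ⟨h0, h1⟩ := Finset.mem_erase.1 hi
      obtain ⟨k, rfl⟩ := Nat.exists_eq_succ_of_ne_zero h0
      exact ⟨k, Finset.mem_preimage.2 h1, rfl⟩
    · intros
      rfl
  rw [e2]
  split_ifs with h0
  · rw [Finset.mul_prod_erase s (fun i => β (t i)) h0]
  · rw [measure_univ, one_mul, Finset.erase_eq_of_notMem h0]

lemma lintegral_infinitePi_seqCons (β : Measure ℝ) [IsProbabilityMeasure β]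
    {F : (ℕ → ℝ) → ENNReal} (hF : Measurable F) :
    ∫⁻ v, F v ∂(Measure.infinitePi fun _ : ℕ => β)
      = ∫⁻ a, ∫⁻ v, F (seqCons a v) ∂(Measure.infinitePi fun _ : ℕ => β) ∂β := by
  have hm : Measurable fun p : ℝ × (ℕ → ℝ) => seqCons p.1 p.2 := by fun_prop
  conv_lhs => rw [← infinitePi_map_seqCons β]
  rw [lintegral_map hF hm]
  exact lintegral_prod _ (hF.comp hm).aemeasurable

/-! ### Stick-breaking -/

/-- The stick-breaking weights of a deterministic sequence of proportions. -/
def breakStick (v : ℕ → ℝ) : ℕ → ℝ := fun j => stickBreaking (fun i (v : ℕ → ℝ) => v i) j v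

@[fun_prop]
lemma measurable_breakStick : Measurable breakStick := by
  unfold breakStick stickBreaking
  fun_prop

lemma breakStick_seqCons (a : ℝ) (v : ℕ → ℝ) :
    breakStick (seqCons a v) = seqCons a ((1 - a) • breakStick v) := by
  funext n
  cases n with
  | zero => simp [breakStick, stickBreaking]
  | succ n =>
    simp only [breakStick, stickBreaking, Finset.prod_range_succ', seqCons_succ, seqCons_zero,
      Pi.smul_apply, smul_eq_mul]
    ring

lemma residualMass_breakStick (v : ℕ → ℝ) (n : ℕ) :
    residualMass (breakStick v) n = ∏ i ∈ Finset.range n, (1 - v i) := by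
  induction n with
  | zero => simp [residualMass]
  | succ n ih =>
    rw [residualMass_succ, ih, Finset.prod_range_succ, breakStick, stickBreaking]
    ring

lemma residualMass_breakStick_seqCons (a : ℝ) (v : ℕ → ℝ) (n : ℕ) :
    residualMass (breakStick (seqCons a v)) (n + 1)
      = (1 - a) * residualMass (breakStick v) n := by
  simp [residualMass_breakStick, Finset.prod_range_succ', mul_comm]

/-! ### Swap invariance of the stick-breaking weights -/

/-- The symmetric kernel `c ^ 2 (1 - x - z) ^ (θ - 1)` on the simplex `x, z > 0`, `x + z < 1`,
where `c` is the normalizing constant of the law `Be(1, θ)`. -/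
noncomputable def simplexDensity (θ x z : ℝ) : ENNReal :=
  if 0 < x ∧ 0 < z ∧ x + z < 1 then
    ENNReal.ofReal ((1 / ProbabilityTheory.beta 1 θ) ^ 2 * (1 - x - z) ^ (θ - 1)) else 0

lemma simplexDensity_comm (θ x z : ℝ) : simplexDensity θ x z = simplexDensity θ z x := by
  unfold simplexDensity
  rw [show (1 : ℝ) - x - z = 1 - z - x by ring]
  exact if_congr (by rw [add_comm]; tauto) rfl rfl

lemma measurable_simplexDensity (θ : ℝ) :
    Measurable fun q : ℝ × ℝ => simplexDensity θ q.1 q.2 := by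
  unfold simplexDensity
  refine Measurable.ite ?_ (by fun_prop) measurable_const
  exact (measurableSet_lt measurable_const measurable_fst).inter
    ((measurableSet_lt measurable_const measurable_snd).inter
      (measurableSet_lt (measurable_fst.add measurable_snd) measurable_const))

lemma betaPDF_mul_betaPDF_div {θ : ℝ} (hθ : 0 < θ) (a z : ℝ) :
    betaPDF 1 θ a * betaPDF 1 θ (z / (1 - a)) = simplexDensity θ a z := by
  by_cases ha : 0 < a ∧ a < 1
  · have h1 : 0 < 1 - a := sub_pos.2 ha.2
    have hc : 0 ≤ 1 / ProbabilityTheory.beta 1 θ := (one_div_pos.2 (beta_pos one_pos hθ)).le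
    by_cases hz : 0 < z ∧ a + z < 1
    · have h2 : 0 < z / (1 - a) := div_pos hz.1 h1
      have h3 : z / (1 - a) < 1 := (div_lt_one h1).2 (by linarith [hz.2])
      have h4 : (1 - a) * (1 - z / (1 - a)) = 1 - a - z := by field_simp
      rw [betaPDF_of_pos_lt_one ha.1 ha.2, betaPDF_of_pos_lt_one h2 h3, simplexDensity,
        if_pos ⟨ha.1, hz⟩, ← h4, Real.mul_rpow h1.le (by linarith), sub_self, Real.rpow_zero,
        Real.rpow_zero, ← ENNReal.ofReal_mul (by positivity)]
      congr 1
      ring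
    · rw [simplexDensity, if_neg fun h => hz h.2]
      have : ¬ (0 < z / (1 - a) ∧ z / (1 - a) < 1) := fun h => hz
        ⟨by simpa [h1] using (div_pos_iff_of_pos_right h1).1 h.1,
          by linarith [(div_lt_one h1).1 h.2]⟩
      rw [betaPDF_eq 1 θ (z / (1 - a)), if_neg this, ENNReal.ofReal_zero, mul_zero]
  · rw [betaPDF_eq 1 θ a, if_neg ha, ENNReal.ofReal_zero, zero_mul, simplexDensity,
      if_neg fun h => ha ⟨h.1, by linarith [h.2.1, h.2.2]⟩]

lemma lintegral_betaMeasure (a b : ℝ) {f : ℝ → ENNReal} (hf : Measurable f) :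
    ∫⁻ x, f x ∂betaMeasure a b = ∫⁻ x, betaPDF a b x * f x := by
  exact lintegral_withDensity_eq_lintegral_mul _
    (measurable_betaPDFReal a b).ennreal_ofReal hf

/-- The joint law of the first two weights `a` and `(1 - a) b`, with the density `1 - a`. The
substitution `z = (1 - a) b` absorbs the factor `1 - a`. -/
lemma lintegral_first_two_weights {θ : ℝ} (hθ : 0 < θ) {K : ℝ → ℝ → ENNReal}
    (hK : Measurable (Function.uncurry K)) :
    ∫⁻ a, ∫⁻ b, ENNReal.ofReal (1 - a) * K a ((1 - a) * b) ∂betaMeasure 1 θ ∂betaMeasure 1 θ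
      = ∫⁻ x, ∫⁻ z, simplexDensity θ x z * K x z := by
  have := isProbabilityMeasureBeta one_pos hθ
  have hKm : ∀ a, Measurable (K a) := fun a => hK.comp (measurable_const.prodMk measurable_id)
  have hpdf : Measurable (betaPDF 1 θ) := (measurable_betaPDFReal 1 θ).ennreal_ofReal
  have hm : Measurable fun q : ℝ × ℝ => ENNReal.ofReal (1 - q.1) * K q.1 ((1 - q.1) * q.2) := by
    have : Measurable fun q : ℝ × ℝ => K q.1 ((1 - q.1) * q.2) :=
      hK.comp (show Measurable fun q : ℝ × ℝ => (q.1, (1 - q.1) * q.2) by fun_prop)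
    fun_prop
  rw [lintegral_betaMeasure 1 θ (Measurable.lintegral_prod_right hm)]
  refine lintegral_congr fun a => ?_
  by_cases ha : 0 < a ∧ a < 1
  · have h1 : 0 < 1 - a := sub_pos.2 ha.2
    rw [lintegral_betaMeasure 1 θ (by
      exact ((hKm a).comp (measurable_const_mul (1 - a))).const_mul (ENNReal.ofReal (1 - a)))]
    have hg : Measurable fun z => betaPDF 1 θ (z / (1 - a)) * K a z :=
      (hpdf.comp (by fun_prop)).mul (hKm a)
    have hsub : ∫⁻ z, betaPDF 1 θ (z / (1 - a)) * K a z
        = ENNReal.ofReal (1 - a) * ∫⁻ b, betaPDF 1 θ b * K a ((1 - a) * b) := by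
      conv_lhs => rw [← Real.smul_map_volume_mul_left h1.ne']
      rw [lintegral_smul_measure, lintegral_map hg (by fun_prop), abs_of_pos h1]
      simp only [mul_div_cancel_left₀ _ h1.ne', smul_eq_mul]
    have hpull : ∫⁻ b, betaPDF 1 θ b * (ENNReal.ofReal (1 - a) * K a ((1 - a) * b))
        = ENNReal.ofReal (1 - a) * ∫⁻ b, betaPDF 1 θ b * K a ((1 - a) * b) := by
      rw [← lintegral_const_mul]
      · exact lintegral_congr fun b => mul_left_comm _ _ _
      · exact hpdf.mul ((hKm a).comp (by fun_prop))
    refine (congrArg _ (hpull.trans hsub.symm)).trans ?_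
    rw [← lintegral_const_mul _ hg]
    refine lintegral_congr fun z => ?_
    rw [← mul_assoc, betaPDF_mul_betaPDF_div hθ]
  · have h0 : betaPDF 1 θ a = 0 := by rw [betaPDF_eq, if_neg ha, ENNReal.ofReal_zero]
    simp only [← betaPDF_mul_betaPDF_div hθ, h0, zero_mul, lintegral_zero]

/-- The law of the first two weights, with the density `1 - a`, is symmetric. -/
lemma lintegral_first_two_weights_swap {θ : ℝ} (hθ : 0 < θ) {K : ℝ → ℝ → ENNReal}
    (hK : Measurable (Function.uncurry K)) :
    ∫⁻ a, ∫⁻ b, ENNReal.ofReal (1 - a) * K ((1 - a) * b) a ∂betaMeasure 1 θ ∂betaMeasure 1 θ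
      = ∫⁻ a, ∫⁻ b, ENNReal.ofReal (1 - a) * K a ((1 - a) * b) ∂betaMeasure 1 θ
          ∂betaMeasure 1 θ := by
  have hK' : Measurable (Function.uncurry fun x z => K z x) := hK.comp measurable_swap
  rw [lintegral_first_two_weights hθ hK', lintegral_first_two_weights hθ hK,
    lintegral_lintegral_swap ((measurable_simplexDensity θ).mul hK').aemeasurable]
  simp only [simplexDensity_comm θ]

/-- Swap invariance of the stick-breaking weights. Splitting off the first proportion reduces the
exchange at `m + 1` to the exchange at `m`; for `m = 0`, the remaining weights are a function of
`x + z` and of the later proportions, `x` and `z` being the first two weights, and the reweighted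
law of `(x, z)` is symmetric. -/
lemma lintegral_breakStick_comp_swap {θ : ℝ} (hθ : 0 < θ) (m : ℕ) {F : (ℕ → ℝ) → ENNReal}
    (hF : Measurable F) :
    ∫⁻ v, ENNReal.ofReal (residualMass (breakStick v) (m + 1))
        * F (breakStick v ∘ Equiv.swap m (m + 1)) ∂(Measure.infinitePi fun _ => betaMeasure 1 θ)
      = ∫⁻ v, ENNReal.ofReal (residualMass (breakStick v) (m + 1)) * F (breakStick v)
          ∂(Measure.infinitePi fun _ => betaMeasure 1 θ) := by
  have := isProbabilityMeasureBeta one_pos hθ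
  have hsw : ∀ {F : (ℕ → ℝ) → ENNReal}, Measurable F → ∀ m, Measurable fun v =>
      ENNReal.ofReal (residualMass (breakStick v) (m + 1))
        * F (breakStick v ∘ Equiv.swap m (m + 1)) := fun {F} hF m => by
    have : Measurable fun v => F (breakStick v ∘ Equiv.swap m (m + 1)) :=
      hF.comp ((measurable_comp_perm _).comp measurable_breakStick)
    fun_prop
  have hid : ∀ {F : (ℕ → ℝ) → ENNReal}, Measurable F → ∀ m, Measurable fun v =>
      ENNReal.ofReal (residualMass (breakStick v) (m + 1)) * F (breakStick v) := fun {F} hF m => by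
    fun_prop
  induction m generalizing F with
  | zero =>
    set K : ℝ → ℝ → ENNReal := fun x z => ∫⁻ v,
      F (seqCons x (seqCons z ((1 - x - z) • breakStick v)))
        ∂(Measure.infinitePi fun _ => betaMeasure 1 θ) with hK
    have hKm : Measurable (Function.uncurry K) := by
      have : Measurable fun p : (ℝ × ℝ) × (ℕ → ℝ) =>
          F (seqCons p.1.1 (seqCons p.1.2 ((1 - p.1.1 - p.1.2) • breakStick p.2))) := by
        fun_prop
      exact this.lintegral_prod_right
    have key : ∀ a b v, breakStick (seqCons a (seqCons b v))
        = seqCons a (seqCons ((1 - a) * b) ((1 - a - (1 - a) * b) • breakStick v)) := by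
      intro a b v
      rw [breakStick_seqCons, breakStick_seqCons, smul_seqCons, smul_smul]
      congr 4
      ring
    have hres : ∀ a v, residualMass (breakStick (seqCons a v)) (0 + 1) = 1 - a := fun a v => by
      rw [residualMass_breakStick_seqCons]
      simp [residualMass]
    have hFm : ∀ x z, Measurable fun v => F (seqCons x (seqCons z ((1 - x - z) • breakStick v))) :=
      fun x z => by fun_prop
    rw [lintegral_infinitePi_seqCons _ (hsw hF 0), lintegral_infinitePi_seqCons _ (hid hF 0)]
    have e1 : ∀ a, ∫⁻ v, ENNReal.ofReal (residualMass (breakStick (seqCons a v)) (0 + 1))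
        * F (breakStick (seqCons a v) ∘ Equiv.swap 0 (0 + 1))
          ∂(Measure.infinitePi fun _ => betaMeasure 1 θ)
        = ∫⁻ b, ENNReal.ofReal (1 - a) * K ((1 - a) * b) a ∂betaMeasure 1 θ := by
      intro a
      rw [lintegral_infinitePi_seqCons _ (by
        exact (hsw hF 0).comp (measurable_const.seqCons measurable_id))]
      refine lintegral_congr fun b => ?_
      rw [hK, ← lintegral_const_mul _ (hFm _ _)]
      refine lintegral_congr fun v => ?_
      rw [hres, key, zero_add, seqCons_seqCons_comp_swap, sub_right_comm]
    have e2 : ∀ a, ∫⁻ v, ENNReal.ofReal (residualMass (breakStick (seqCons a v)) (0 + 1))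
        * F (breakStick (seqCons a v)) ∂(Measure.infinitePi fun _ => betaMeasure 1 θ)
        = ∫⁻ b, ENNReal.ofReal (1 - a) * K a ((1 - a) * b) ∂betaMeasure 1 θ := by
      intro a
      rw [lintegral_infinitePi_seqCons _ (by
        exact (hid hF 0).comp (measurable_const.seqCons measurable_id))]
      refine lintegral_congr fun b => ?_
      rw [hK, ← lintegral_const_mul _ (hFm _ _)]
      refine lintegral_congr fun v => ?_
      rw [hres, key]
    simp only [e1, e2]
    exact lintegral_first_two_weights_swap hθ hKm
  | succ m ih =>
    rw [lintegral_infinitePi_seqCons _ (hsw hF _), lintegral_infinitePi_seqCons _ (hid hF _)]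
    refine lintegral_congr_ae ?_
    filter_upwards [betaMeasure_ae_mem_Ioo 1 θ] with a ha
    have h1 : 0 ≤ 1 - a := sub_nonneg.2 ha.2.le
    have hFa : Measurable fun s : ℕ → ℝ => F (seqCons a ((1 - a) • s)) := by fun_prop
    simp only [residualMass_breakStick_seqCons, ENNReal.ofReal_mul h1, mul_assoc]
    have hcomp : ∀ v, breakStick (seqCons a v) ∘ Equiv.swap (m + 1) (m + 1 + 1)
        = seqCons a ((1 - a) • (breakStick v ∘ Equiv.swap m (m + 1))) := fun v => by
      rw [breakStick_seqCons, seqCons_comp_swap_succ]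
      rfl
    simp only [hcomp]
    simp only [breakStick_seqCons]
    refine (lintegral_const_mul _ (hsw hFa m)).trans ?_
    rw [ih hFa]
    exact (lintegral_const_mul _ (hid hFa m)).symm

/-! ### The stick-breaking weights are proper -/

/-- The residual masses have the means `c ^ n` with `c = E (1 - v 0) < 1`, so that their sum has
finite mean. -/
lemma ae_tendsto_residualMass_breakStick {θ : ℝ} (hθ : 0 < θ) :
    ∀ᵐ v ∂(Measure.infinitePi fun _ : ℕ => betaMeasure 1 θ),
      Tendsto (fun n => ENNReal.ofReal (residualMass (breakStick v) n)) atTop (𝓝 0) := by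
  have := isProbabilityMeasureBeta one_pos hθ
  set c : ENNReal := ∫⁻ a, ENNReal.ofReal (1 - a) ∂betaMeasure 1 θ with hc
  have hpow : ∀ n, ∫⁻ v, ENNReal.ofReal (residualMass (breakStick v) n)
      ∂(Measure.infinitePi fun _ : ℕ => betaMeasure 1 θ) = c ^ n := by
    intro n
    induction n with
    | zero => simp [residualMass]
    | succ n ih =>
      rw [lintegral_infinitePi_seqCons _ (by fun_prop), pow_succ', hc,
        ← lintegral_mul_const _ (by fun_prop)]
      refine lintegral_congr_ae ?_
      filter_upwards [betaMeasure_ae_mem_Ioo 1 θ] with a ha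
      simp only [residualMass_breakStick_seqCons, ENNReal.ofReal_mul (sub_nonneg.2 ha.2.le)]
      rw [lintegral_const_mul _ (by fun_prop), ih]
  have hc1 : c < 1 := by
    have hsum : c + ∫⁻ a, ENNReal.ofReal a ∂betaMeasure 1 θ = 1 := by
      rw [hc, ← lintegral_add_left (by fun_prop), ← measure_univ (μ := betaMeasure 1 θ),
        ← lintegral_one]
      refine lintegral_congr_ae ?_
      filter_upwards [betaMeasure_ae_mem_Ioo 1 θ] with a ha
      rw [← ENNReal.ofReal_add (sub_nonneg.2 ha.2.le) ha.1.le, sub_add_cancel, ENNReal.ofReal_one]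
    refine lt_of_le_of_ne (hsum ▸ le_self_add) fun h => ?_
    rw [h] at hsum
    have h0 : ∫⁻ a, ENNReal.ofReal a ∂betaMeasure 1 θ = 0 := by
      have : (1 : ENNReal) + ∫⁻ a, ENNReal.ofReal a ∂betaMeasure 1 θ = 1 + 0 := by
        rw [hsum, add_zero]
      exact (ENNReal.add_right_inj ENNReal.one_ne_top).1 this
    rw [lintegral_eq_zero_iff (by fun_prop)] at h0
    obtain ⟨a, ha, hI⟩ := (h0.and (betaMeasure_ae_mem_Ioo 1 θ)).exists
    exact absurd hI.1 (not_lt.2 (ENNReal.ofReal_eq_zero.1 ha))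
  have hfin : ∫⁻ v, ∑' n, ENNReal.ofReal (residualMass (breakStick v) n)
      ∂(Measure.infinitePi fun _ : ℕ => betaMeasure 1 θ) ≠ ⊤ := by
    rw [lintegral_tsum fun n => by fun_prop]
    simp only [hpow, ENNReal.tsum_geometric]
    exact ENNReal.inv_ne_top.2 (tsub_pos_of_lt hc1).ne'
  filter_upwards [ae_lt_top' (by fun_prop) hfin] with v hv
  exact ENNReal.tendsto_atTop_zero_of_tsum_ne_top hv.ne

/-- Two stick-breaking weights are almost surely distinct: after splitting off the common factors,
`v 0` would have to be a given function of the later proportions, and `Be(1, θ)` has no atoms. -/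
lemma ae_breakStick_ne {θ : ℝ} (hθ : 0 < θ) (i k : ℕ) :
    ∀ᵐ v ∂(Measure.infinitePi fun _ : ℕ => betaMeasure 1 θ),
      breakStick v i ≠ breakStick v (i + 1 + k) := by
  have := isProbabilityMeasureBeta one_pos hθ
  have hm : ∀ i j, MeasurableSet {v : ℕ → ℝ | breakStick v i ≠ breakStick v j} := fun i j =>
    (measurableSet_eq_fun (by fun_prop) (by fun_prop)).compl
  have hcons : Measurable fun p : ℝ × (ℕ → ℝ) => seqCons p.1 p.2 := by fun_prop
  induction i with
  | zero =>
    rw [← infinitePi_map_seqCons, ae_map_iff hcons.aemeasurable (hm _ _)]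
    refine (Measure.ae_prod_iff_ae_ae (by exact hcons (hm _ _))).2 ?_
    refine (Measure.ae_ae_comm (by exact hcons (hm _ _))).2 (Eventually.of_forall fun v => ?_)
    have hnull : betaMeasure 1 θ {a | a = (1 - a) * breakStick v k} = 0 := by
      refine withDensity_absolutelyContinuous _ _ (Set.Subsingleton.measure_zero ?_ _)
      intro a ha b hb
      have ha' : a = (1 - a) * breakStick v k := ha
      have hb' : b = (1 - b) * breakStick v k := hb
      have h1 : (a - b) * (1 + breakStick v k) = 0 := by linear_combination ha' - hb'
      rcases mul_eq_zero.1 h1 with h | h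
      · exact sub_eq_zero.1 h
      · rw [eq_neg_of_add_eq_zero_right h] at ha'
        linarith
    refine measure_mono_null (fun a ha => ?_) hnull
    have ha' := not_not.1 ha
    rw [breakStick_seqCons, zero_add, add_comm 1 k] at ha'
    exact ha'
  | succ i ih =>
    rw [← infinitePi_map_seqCons, ae_map_iff hcons.aemeasurable (hm _ _)]
    refine (Measure.ae_prod_iff_ae_ae (by exact hcons (hm _ _))).2 ?_
    filter_upwards [betaMeasure_ae_mem_Ioo 1 θ] with a ha
    filter_upwards [ih] with v hv
    rw [breakStick_seqCons, show i + 1 + 1 + k = (i + 1 + k) + 1 by ring]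
    simpa [(sub_pos.2 ha.2).ne'] using hv

lemma ae_isProperWeights_breakStick {θ : ℝ} (hθ : 0 < θ) :
    ∀ᵐ v ∂(Measure.infinitePi fun _ : ℕ => betaMeasure 1 θ), IsProperWeights (breakStick v) := by
  have := isProbabilityMeasureBeta one_pos hθ
  have hI : ∀ᵐ v ∂(Measure.infinitePi fun _ : ℕ => betaMeasure 1 θ),
      ∀ i, v i ∈ Set.Ioo (0 : ℝ) 1 := ae_all_iff.2 fun i =>
    (measurePreserving_eval_infinitePi (fun _ : ℕ => betaMeasure 1 θ) i).quasiMeasurePreserving.ae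
      (betaMeasure_ae_mem_Ioo 1 θ)
  filter_upwards [hI, ae_tendsto_residualMass_breakStick hθ,
    ae_all_iff.2 fun i => ae_all_iff.2 fun k => ae_breakStick_ne hθ i k] with v hv hr hne
  have hpos : ∀ i, 0 < breakStick v i := fun i =>
    mul_pos (hv i).1 (Finset.prod_pos fun k _ => sub_pos.2 (hv k).2)
  refine ⟨hpos, fun i j hij => ?_, ?_⟩
  · rcases lt_trichotomy i j with h | h | h
    · obtain ⟨k, rfl⟩ := Nat.exists_eq_add_of_lt h
      exact absurd hij (by rw [add_right_comm]; exact hne i k)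
    · exact h
    · obtain ⟨k, rfl⟩ := Nat.exists_eq_add_of_lt h
      exact absurd hij.symm (by rw [add_right_comm]; exact hne j k)
  · have hr0 : ∀ n, 0 ≤ residualMass (breakStick v) n := fun n => by
      rw [residualMass_breakStick]
      exact Finset.prod_nonneg fun i _ => sub_nonneg.2 (hv i).2.le
    have h1 : Tendsto (residualMass (breakStick v)) atTop (𝓝 0) := by
      have := (ENNReal.tendsto_toReal ENNReal.zero_ne_top).comp hr
      simpa [Function.comp_def, ENNReal.toReal_ofReal (hr0 _)] using this
    rw [hasSum_iff_tendsto_nat_of_nonneg fun i => (hpos i).le]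
    have h2 := (tendsto_const_nhds (x := (1 : ℝ))).sub h1
    rw [sub_zero] at h2
    exact h2.congr fun n => by rw [residualMass, sub_sub_cancel]

lemma measurableSet_isProperWeights : MeasurableSet {s : ℕ → ℝ | IsProperWeights s} := by
  have e : {s : ℕ → ℝ | IsProperWeights s} = (⋂ i, {s | 0 < s i}) ∩
      ((⋂ i, ⋂ j, ⋂ _ : i ≠ j, {s | s i ≠ s j}) ∩
        {s | Tendsto (fun n => ∑ i ∈ Finset.range n, s i) atTop (𝓝 1)}) := by
    ext s
    simp only [Set.mem_inter_iff, Set.mem_iInter, Set.mem_ofPred_eq]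
    constructor
    · exact fun hs => ⟨hs.pos, fun i j hij h => hij (hs.injective h), hs.hasSum.tendsto_sum_nat⟩
    · rintro ⟨h1, h2, h3⟩
      exact ⟨h1, fun i j hij => by_contra fun h => h2 i j h hij,
        (hasSum_iff_tendsto_nat_of_nonneg (fun i => (h1 i).le) 1).2 h3⟩
  rw [e]
  refine (MeasurableSet.iInter fun i => measurableSet_lt measurable_const
    (measurable_pi_apply i)).inter (MeasurableSet.inter ?_ ?_)
  · exact MeasurableSet.iInter fun i => MeasurableSet.iInter fun j => MeasurableSet.iInter fun _ =>
      (measurableSet_eq_fun (measurable_pi_apply i) (measurable_pi_apply j)).compl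
  · exact measurableSet_tendsto (𝓝 1) fun n => by fun_prop

/-- For independent proportions with law `Be(1, θ)`, the stick-breaking weights are size-biased
ordered. -/
theorem IsBetaChain.isSizeBiasedOrdered_stickBreaking {Ω : Type*} [MeasurableSpace Ω]
    {P : Measure Ω} [IsProbabilityMeasure P] {θ : ℝ} (hθ : 0 < θ) {V : ℕ → Ω → ℝ}
    (h : IsBetaChain P 0 1 θ V) : IsSizeBiasedOrdered P (stickBreaking V) := by
  have := isProbabilityMeasureBeta one_pos hθ
  have hV : Measurable fun ω i => V i ω := measurable_pi_lambda _ h.measurable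
  have : IsProbabilityMeasure ((Measure.infinitePi fun _ : ℕ => betaMeasure 1 θ).map breakStick) :=
    Measure.isProbabilityMeasure_map measurable_breakStick.aemeasurable
  refine isSizeBiasedOrdered_of_isAdjacentSwapInvariant
    (μ := (Measure.infinitePi fun _ : ℕ => betaMeasure 1 θ).map breakStick) ?_ ?_ ?_
  · rw [← h.map_eq_infinitePi hθ, Measure.map_map measurable_breakStick hV]
    rfl
  · intro m F hF
    have hF' : Measurable fun s : ℕ → ℝ => F (s ∘ Equiv.swap m (m + 1)) :=
      hF.comp (measurable_comp_perm _)
    rw [lintegral_map (by fun_prop) measurable_breakStick,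
      lintegral_map (by fun_prop) measurable_breakStick]
    exact lintegral_breakStick_comp_swap hθ m hF
  · exact (ae_map_iff measurable_breakStick.aemeasurable measurableSet_isProperWeights).2
      (ae_isProperWeights_breakStick hθ)

theorem mainTheorem3 :
    (∀ (θ : ℝ), 0 < θ →
      ∀ (Ω : Type*) (_ : MeasurableSpace Ω) (P : Measure Ω) (_ : IsProbabilityMeasure P)
        (V : ℕ → Ω → ℝ), IsBetaChain P 0 1 θ V → IsSizeBiasedOrdered P (stickBreaking V)) ∧
    (∀ (α θ : ℝ), 0 < α → 0 < θ →
      ∀ (Ω : ℕ → Type*) (_ : ∀ κ, MeasurableSpace (Ω κ)) (P : ∀ κ, Measure (Ω κ))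
        (_ : ∀ κ, IsProbabilityMeasure (P κ)) (V : ∀ κ, ℕ → Ω κ → ℝ),
        (∀ κ, IsBetaChain (P κ) κ α θ (V κ)) →
        ∀ j : ℕ,
          Tendsto
            (fun κ => P κ {ω | stickBreaking (V κ) (j + 1) ω < stickBreaking (V κ) j ω})
            atTop (𝓝 1)) :=
  ⟨fun _ hθ _ _ _ _ _ h => h.isSizeBiasedOrdered_stickBreaking hθ,
    fun _ _ hα hθ _ _ _ _ _ h j => tendsto_measure_stickBreaking_succ_lt hα hθ h j⟩
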